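/- Let $\rho=\beta+i\gamma$ denote the nontrivial zeros of the Riemann zeta-function $\zeta(s)$, i.e. those with $0<\beta<1$, and let $m_\rho$ be the multiplicity of $\rho$. For $T>1$ put $L=\frac{1}{2\pi}\log T$. Let $$N(T)=\sum_{0<\gamma\le T}1,\qquad N^{\circledast}(T)=\sum_{\substack{\rho,\rho'\\ 0<\gamma,\gamma'\le T\\ \gamma=\gamma'}}1,\qquad N_0(T)=\sum_{\substack{0<\gamma\le T\\ \beta=1/2}}1,\qquad N_s(T)=\sum_{\substack{0<\gamma\le T\\ m_\rho=1}}1,\qquad N_{0,s}(T)=\sum_{\substack{0<\gamma\le T\\ \beta=1/2,\ m_\rho=1}}1,$$ where in every sum zeros are counted with multiplicity (so an ordered pair of points $(\rho,\rho')$, possibly $\rho=\rho'$, contributes $m_\rho m_{\rho'}$ to $N^{\circledast}(T)$). Assume that $N^{\circledast}(T)=TL+o(TL)$ as $T\to\infty$. Then asymptotically $100\%$ of the nontrivial zeros of $\zeta$ are simple and on the critical line: as $T\to\infty$, $$N_s(T)\sim N(T),\qquad N_0(T)\sim N(T),\qquad\text{and}\qquad N_{0,s}(T)\sim N(T).$$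 -/

import Mathlib

noncomputable section

namespace ZetaPairs

/-- The nontrivial zeros `ρ = β + iγ` of `ζ` (those in the strip `0 < β < 1`) with `0 < γ ≤ T`,
as a set, so without repetition. -/
def zerosUpToSet (T : ℝ) : Set ℂ :=
  {ρ : ℂ | riemannZeta ρ = 0 ∧ 0 < ρ.re ∧ ρ.re < 1 ∧ 0 < ρ.im ∧ ρ.im ≤ T}

theorem zerosUpToSet_finite (T : ℝ) : (zerosUpToSet T).Finite := by
  have hc : IsCompact (Set.Icc (0 : ℝ) 1 ×ℂ Set.Icc (0 : ℝ) T) :=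
    isCompact_Icc.reProdIm isCompact_Icc
  refine hc.inter_riemannZetaZeros_finite.subset ?_
  rintro ρ ⟨h0, h1, h2, h3, h4⟩
  exact ⟨⟨⟨h1.le, h2.le⟩, ⟨h3.le, h4⟩⟩, h0⟩

/-- The finite set of distinct nontrivial zeros with `0 < γ ≤ T`. -/
def zerosUpTo (T : ℝ) : Finset ℂ := (zerosUpToSet_finite T).toFinset

/-- The multiplicity `m_ρ` of `ρ` as a zero of `ζ`. -/
def mult (ρ : ℂ) : ℕ := analyticOrderNatAt riemannZeta ρ

/-- `L = (log T) / (2π)`. -/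
def L (T : ℝ) : ℝ := Real.log T / (2 * Real.pi)

/-- `N(T)`: the number of zeros with `0 < γ ≤ T`, counted with multiplicity. -/
def N (T : ℝ) : ℕ := ∑ ρ ∈ zerosUpTo T, mult ρ

/-- `N^⊛(T)`: the number of pairs `(ρ, ρ')` of zeros with `0 < γ, γ' ≤ T` and `γ = γ'`, both `ρ`
and `ρ'` being counted with multiplicity. -/
def NCirc (T : ℝ) : ℕ :=
  ∑ ρ ∈ zerosUpTo T, ∑ ρ' ∈ zerosUpTo T with ρ.im = ρ'.im, mult ρ * mult ρ'

/-- `N_s(T)`: the number of simple zeros with `0 < γ ≤ T`. -/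
def NSimple (T : ℝ) : ℕ := ((zerosUpTo T).filter fun ρ => mult ρ = 1).card

/-- `N_0(T)`: the number of zeros with `0 < γ ≤ T` and `β = 1/2`, counted with multiplicity. -/
def NLine (T : ℝ) : ℕ := ∑ ρ ∈ zerosUpTo T with ρ.re = 1 / 2, mult ρ

/-- The number of zeros with `0 < γ ≤ T` that are simple and also satisfy `β = 1/2`. -/
def NSimpleLine (T : ℝ) : ℕ :=
  ((zerosUpTo T).filter fun ρ => mult ρ = 1 ∧ ρ.re = 1 / 2).card

/-- Hypothesis ES1: `N^⊛(T) = T L + o(T L)` as `T → ∞`. -/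
def ES1 : Prop :=
  (fun T : ℝ => (NCirc T : ℝ) - T * L T) =o[Filter.atTop] fun T : ℝ => T * L T

end ZetaPairs

end

/-! The functional equation and conjugation make the zeros symmetric under `ρ ↦ 1 - conj ρ`, which
preserves heights. Let `S` be the total multiplicity of the zeros at the height of `ρ`. Then `S ≥ 2`
if `ρ` is multiple, and also if it is off the line, because the reflected zero contributes. Hence `2
m_ρ ≤ m_ρ S`, except when `ρ` is simple and on the line, where adding 1 repairs the inequality.
Summing gives `2 N ≤ N^⊛ + N_{0,s}` (`two_mul_N_le`). Once `N ~ T L` is known, `N^⊛ - N = o(N)`, so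
`N_{0,s}`, and the larger counts `N_s` and `N_0`, are all asymptotic to `N`.

Most of the proof establishes `N ~ T L` (`isEquivalent_N`). The hypothesis supplies the upper half,
because `N ≤ N^⊛`. The lower half is Tauberian. A finite Hadamard factorization compares `log |xi
x|`, which is at least `(x/2) log x - O(x)` by the size of Gamma, with the zeros: `∑ m_ρ log (1 +
x²/γ²) ≥ (x/2) log x - C x` (`exists_le_sum_log_one_add`). By partial summation the left side is, up
to a vanishing boundary term, the integral of `N(t)/t` against the kernel `2x²/(t² + x²)`, of total
mass `π x`. A main term `N(t) = t L(t)` would give exactly `(x/2) log x`. So the upper bound leaves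
no room for a deficit: if `N(T) < (1 - η) T L(T)`, monotonicity spreads the deficit over an interval
of length proportional to `T`, and the integral at `x = T` becomes too small
(`eventually_le_of_integrated`). -/

namespace ZetaPairs

open Filter Topology Asymptotics ComplexConjugate

/-! ### Multiplicities, reflection in the critical line, and the pair inequality. -/

lemma mem_zerosUpTo {T : ℝ} {ρ : ℂ} :
    ρ ∈ zerosUpTo T ↔
      riemannZeta ρ = 0 ∧ 0 < ρ.re ∧ ρ.re < 1 ∧ 0 < ρ.im ∧ ρ.im ≤ T := by
  simp [zerosUpTo, zerosUpToSet]

lemma analyticAt_riemannZeta {s : ℂ} (hs : s ≠ 1) : AnalyticAt ℂ riemannZeta s :=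
  differentiableOn_riemannZeta.analyticOnNhd isOpen_compl_singleton s hs

/-- Identity theorem on the connected set `{1}ᶜ`. It matters because `analyticOrderNatAt` turns an
infinite order into 0, which would make `mult` meaningless. -/
lemma analyticOrderAt_riemannZeta_ne_top {s : ℂ} (hs : s ≠ 1) :
    analyticOrderAt riemannZeta s ≠ ⊤ := by
  have hU : AnalyticOnNhd ℂ riemannZeta {1}ᶜ := fun z hz => analyticAt_riemannZeta hz
  have hc : IsPreconnected ({1}ᶜ : Set ℂ) :=
    (isConnected_compl_singleton_of_one_lt_rank (by simp) (1 : ℂ)).isPreconnected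
  refine hU.analyticOrderAt_ne_top_of_isPreconnected hc (x := 2) (by simp) hs ?_
  have h2 : riemannZeta 2 ≠ 0 := riemannZeta_ne_zero_of_one_lt_re (by simp)
  rw [(analyticAt_riemannZeta (by simp)).analyticOrderAt_eq_zero.2 h2]
  simp

lemma one_le_mult {T : ℝ} {ρ : ℂ} (hρ : ρ ∈ zerosUpTo T) : 1 ≤ mult ρ := by
  obtain ⟨h0, -, h1, -, -⟩ := mem_zerosUpTo.1 hρ
  have hne : ρ ≠ 1 := by rintro rfl; simp at h1
  have h : analyticOrderAt riemannZeta ρ ≠ 0 :=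
    analyticOrderAt_ne_zero.2 ⟨analyticAt_riemannZeta hne, h0⟩
  rw [Nat.one_le_iff_ne_zero]
  intro h'
  apply h
  rw [← Nat.cast_analyticOrderNatAt (analyticOrderAt_riemannZeta_ne_top hne)]
  change ((mult ρ : ℕ) : ℕ∞) = 0
  simp [h']

lemma one_sub_conj_mem_zerosUpTo {T : ℝ} {ρ : ℂ} (hρ : ρ ∈ zerosUpTo T) :
    1 - conj ρ ∈ zerosUpTo T := by
  obtain ⟨h0, h1, h2, h3, h4⟩ := mem_zerosUpTo.1 hρ
  refine mem_zerosUpTo.2 ⟨?_, by simpa using h2, by simpa using h1, by simpa using h3,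
    by simpa using h4⟩
  rw [riemannZeta_one_sub, riemannZeta_conj, h0]
  · simp
  · intro n hn
    have := congrArg Complex.re hn
    simp at this
    have hn : (0 : ℝ) ≤ n := n.cast_nonneg
    linarith
  · intro hn
    have := congrArg Complex.re hn
    simp at this
    linarith

lemma NSimpleLine_le_NSimple (T : ℝ) : NSimpleLine T ≤ NSimple T := by
  refine Finset.card_le_card fun ρ hρ => ?_
  simp only [Finset.mem_filter] at hρ ⊢
  exact ⟨hρ.1, hρ.2.1⟩

lemma NSimple_le_N (T : ℝ) : NSimple T ≤ N T := by
  rw [NSimple, N, Finset.card_filter]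
  refine Finset.sum_le_sum fun ρ hρ => ?_
  have := one_le_mult hρ
  split_ifs <;> omega

lemma NSimpleLine_le_NLine (T : ℝ) : NSimpleLine T ≤ NLine T := by
  rw [NSimpleLine, NLine, Finset.card_filter, Finset.sum_filter]
  refine Finset.sum_le_sum fun ρ hρ => ?_
  have := one_le_mult hρ
  split_ifs <;> grind

lemma NLine_le_N (T : ℝ) : NLine T ≤ N T :=
  Finset.sum_le_sum_of_subset (Finset.filter_subset _ _)

lemma mult_le_sum_same_height {T : ℝ} {ρ : ℂ} (hρ : ρ ∈ zerosUpTo T) :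
    mult ρ ≤ ∑ ρ' ∈ zerosUpTo T with ρ.im = ρ'.im, mult ρ' :=
  Finset.single_le_sum (f := mult) (fun _ _ => Nat.zero_le _)
    (Finset.mem_filter.2 ⟨hρ, rfl⟩)

/-- A zero off the line shares its height with its reflection in the line. -/
lemma mult_add_one_le_sum_same_height {T : ℝ} {ρ : ℂ} (hρ : ρ ∈ zerosUpTo T)
    (hre : ρ.re ≠ 1 / 2) :
    mult ρ + 1 ≤ ∑ ρ' ∈ zerosUpTo T with ρ.im = ρ'.im, mult ρ' := by
  have hr := one_sub_conj_mem_zerosUpTo hρ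
  have hne : ρ ≠ 1 - conj ρ := by
    intro h
    have := congrArg Complex.re h
    simp at this
    exact hre (by linarith)
  calc mult ρ + 1 ≤ mult ρ + mult (1 - conj ρ) := by have := one_le_mult hr; omega
    _ = ∑ ρ' ∈ {ρ, 1 - conj ρ}, mult ρ' := (Finset.sum_pair hne).symm
    _ ≤ _ := by
      refine Finset.sum_le_sum_of_subset fun z hz => ?_
      rcases Finset.mem_insert.1 hz with rfl | hz
      · exact Finset.mem_filter.2 ⟨hρ, rfl⟩
      · rw [Finset.mem_singleton.1 hz]
        exact Finset.mem_filter.2 ⟨hr, by simp⟩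

lemma two_mul_N_le (T : ℝ) : 2 * N T ≤ NCirc T + NSimpleLine T := by
  rw [N, NCirc, NSimpleLine, Finset.card_filter, ← Finset.sum_add_distrib, Finset.mul_sum]
  refine Finset.sum_le_sum fun ρ hρ => ?_
  rw [← Finset.mul_sum]
  have h1 := one_le_mult hρ
  have h2 := mult_le_sum_same_height hρ
  -- Termwise claim `2 m ≤ m S + [simple and on the line]`. Only in the case `m = 1` on the line can
  -- `S` be 1.
  by_cases hre : ρ.re = 1 / 2
  · by_cases hm : mult ρ = 1
    · rw [if_pos ⟨hm, hre⟩, hm] at *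
      omega
    · have := Nat.mul_le_mul_left (mult ρ) ((show 2 ≤ mult ρ by omega).trans h2)
      omega
  · have := Nat.mul_le_mul_left (mult ρ) ((Nat.add_le_add_right h1 1).trans (mult_add_one_le_sum_same_height hρ hre))
    omega

lemma N_le_NCirc (T : ℝ) : N T ≤ NCirc T := by
  have h1 := two_mul_N_le T
  have h2 := NSimpleLine_le_NSimple T
  have h3 := NSimple_le_N T
  omega

lemma tendsto_mul_L_atTop : Tendsto (fun T : ℝ => T * L T) atTop atTop :=
  tendsto_id.atTop_mul_atTop₀ (Real.tendsto_log_atTop.atTop_div_const (by positivity))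

/-- A quantity `A` with `2 N - N^⊛ ≤ A ≤ N` is asymptotic to `N` once `N` has the expected order. -/
lemma isEquivalent_N_of_two_mul_N_le {A : ℝ → ℕ} (hES1 : ES1)
    (hN : (fun T : ℝ => (N T : ℝ)) ~[atTop] fun T => T * L T)
    (h1 : ∀ T, 2 * N T ≤ NCirc T + A T) (h2 : ∀ T, A T ≤ N T) :
    (fun T : ℝ => (A T : ℝ)) ~[atTop] fun T => (N T : ℝ) := by
  have hd : (fun T : ℝ => (NCirc T : ℝ) - N T) =o[atTop] fun T : ℝ => T * L T := by
    refine (hES1.sub hN.isLittleO).congr_left fun T => ?_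
    simp
  -- The squeeze is `0 ≤ N - A ≤ N^⊛ - N`.
  refine IsLittleO.isEquivalent (((IsBigO.of_norm_le fun T => ?_).trans_isLittleO hd).trans_isBigO
    hN.symm.isBigO)
  have h1' : (2 * N T : ℝ) ≤ NCirc T + A T := by exact_mod_cast h1 T
  have h2' : (A T : ℝ) ≤ N T := by exact_mod_cast h2 T
  rw [Pi.sub_apply, Real.norm_eq_abs, abs_of_nonpos (by linarith)]
  linarith

end ZetaPairs

/-! ### Complex analysis: dividing out zeros and a finite Hadamard inequality. -/

namespace ZetaPairs

open Filter Topology Asymptotics Metric Set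

lemma analyticOrderAt_ne_top_of_entire {f : ℂ → ℂ} (hf : Differentiable ℂ f) {b : ℂ}
    (hb : f b ≠ 0) (a : ℂ) : analyticOrderAt f a ≠ ⊤ := by
  have hU : AnalyticOnNhd ℂ f univ := fun z _ => hf.analyticAt z
  refine hU.analyticOrderAt_ne_top_of_isPreconnected isPreconnected_univ (x := b) (mem_univ _)
    (mem_univ _) ?_
  rw [(hf.analyticAt b).analyticOrderAt_eq_zero.2 hb]
  simp

/-- An entire function can be divided by the power of `z - a` given by its order at `a`. -/
lemma exists_entire_eq_pow_mul {f : ℂ → ℂ} (hf : Differentiable ℂ f) {a : ℂ}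
    (h : analyticOrderAt f a ≠ ⊤) :
    ∃ g : ℂ → ℂ, Differentiable ℂ g ∧ g a ≠ 0 ∧
      ∀ z, f z = (z - a) ^ analyticOrderNatAt f a * g z := by
  obtain ⟨g₀, hg₀, hg₀a, hev⟩ := (hf.analyticAt a).analyticOrderAt_ne_top.1 h
  set n := analyticOrderNatAt f a
  set g : ℂ → ℂ := Function.update (fun z => f z / (z - a) ^ n) a (g₀ a) with hg
  have hga : g a = g₀ a := by simp [hg]
  have hgne : ∀ z, z ≠ a → g z = f z / (z - a) ^ n := fun z hz => by simp [hg, hz]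
  refine ⟨g, fun z => ?_, by rwa [hga], fun z => ?_⟩
  · rcases eq_or_ne z a with rfl | hz
    · refine hg₀.differentiableAt.congr_of_eventuallyEq ?_
      filter_upwards [hev] with w hw
      rcases eq_or_ne w z with rfl | hwz
      · exact hga
      · rw [hgne w hwz, hw, smul_eq_mul,
          mul_div_cancel_left₀ _ (pow_ne_zero _ (sub_ne_zero.2 hwz))]
    · have : DifferentiableAt ℂ (fun z => f z / (z - a) ^ n) z :=
        (hf z).div (by fun_prop) (pow_ne_zero _ (sub_ne_zero.2 hz))
      refine this.congr_of_eventuallyEq ?_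
      filter_upwards [isOpen_ne.mem_nhds hz] with w hw using hgne w hw
  · rcases eq_or_ne z a with rfl | hz
    · rw [hga]
      simpa using hev.self_of_nhds
    · rw [hgne z hz, mul_div_cancel₀ _ (pow_ne_zero _ (sub_ne_zero.2 hz))]

/-- Finitely many zeros of an entire function can be divided out. -/
lemma exists_entire_eq_prod_mul {f : ℂ → ℂ} (hf : Differentiable ℂ f) (h0 : f 0 ≠ 0)
    (S : Finset ℂ) (hS : ∀ a ∈ S, a ≠ 0) :
    ∃ g : ℂ → ℂ, Differentiable ℂ g ∧ (∀ a ∈ S, g a ≠ 0) ∧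
      ∀ z, f z = (∏ a ∈ S, (1 - z / a) ^ analyticOrderNatAt f a) * g z := by
  classical
  induction S using Finset.induction_on with
  | empty => exact ⟨f, hf, by simp, by simp⟩
  | insert a S ha ih =>
    obtain ⟨g, hg, hgS, hfg⟩ := ih fun b hb => hS b (Finset.mem_insert_of_mem hb)
    have ha0 : a ≠ 0 := hS a (Finset.mem_insert_self _ _)
    set P : ℂ → ℂ := fun z => ∏ b ∈ S, (1 - z / b) ^ analyticOrderNatAt f b with hP
    have hPd : Differentiable ℂ P := by fun_prop
    have hPa : P a ≠ 0 := by
      refine Finset.prod_ne_zero_iff.2 fun b hb => pow_ne_zero _ ?_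
      have hb0 : b ≠ 0 := hS b (Finset.mem_insert_of_mem hb)
      intro h
      rw [sub_eq_zero, eq_comm, div_eq_one_iff_eq hb0] at h
      exact ha (h ▸ hb)
    have hord : analyticOrderAt g a = analyticOrderAt f a := by
      have hfe : f = P * g := funext hfg
      rw [hfe, analyticOrderAt_mul (hPd.analyticAt a) (hg.analyticAt a),
        (hPd.analyticAt a).analyticOrderAt_eq_zero.2 hPa, zero_add]
    have htop := analyticOrderAt_ne_top_of_entire hf h0 a
    obtain ⟨g₁, hg₁, hg₁a, hgg₁⟩ := exists_entire_eq_pow_mul hg (hord.symm ▸ htop)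
    have hordN : analyticOrderNatAt g a = analyticOrderNatAt f a := by
      simp only [analyticOrderNatAt, hord]
    rw [hordN] at hgg₁
    -- The power of `-a` turns `z - a` into `1 - z / a`. With this normalization the product is 1 at
    -- the origin, so the cofactor keeps the value `f 0`.
    refine ⟨fun z => (-a) ^ analyticOrderNatAt f a * g₁ z, by fun_prop, fun b hb => ?_,
      fun z => ?_⟩
    · refine mul_ne_zero (pow_ne_zero _ (neg_ne_zero.2 ha0)) ?_
      rcases Finset.mem_insert.1 hb with rfl | hb
      · exact hg₁a
      · intro h
        exact hgS b hb (by rw [hgg₁, h, mul_zero])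
    · rw [Finset.prod_insert ha, hfg, hgg₁]
      have : (z - a) ^ analyticOrderNatAt f a =
          (1 - z / a) ^ analyticOrderNatAt f a * (-a) ^ analyticOrderNatAt f a := by
        rw [← mul_pow]
        congr 1
        field_simp
        ring
      rw [this]
      ring

/-- A nonvanishing holomorphic function on a disc has a logarithm there. -/
lemma exists_log_on_ball {g : ℂ → ℂ} {R : ℝ} (hR : 0 < R) (hg : DifferentiableOn ℂ g (ball 0 R))
    (hne : ∀ z ∈ ball (0 : ℂ) R, g z ≠ 0) :
    ∃ h : ℂ → ℂ, DifferentiableOn ℂ h (ball 0 R) ∧ h 0 = 0 ∧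
      ∀ z ∈ ball (0 : ℂ) R, g z = g 0 * Complex.exp (h z) := by
  have hd : DifferentiableOn ℂ (fun z => deriv g z / g z) (ball 0 R) :=
    (hg.deriv isOpen_ball).div hg hne
  obtain ⟨h, hh⟩ := hd.isExactOn_ball
  have h0 : (0 : ℂ) ∈ ball (0 : ℂ) R := mem_ball_self hR
  have hc : ∀ z ∈ ball (0 : ℂ) R, HasDerivAt (fun z => g z * Complex.exp (-h z)) 0 z := by
    intro z hz
    have h1 := ((hg.differentiableAt (isOpen_ball.mem_nhds hz)).hasDerivAt).mul (hh z hz).neg.cexp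
    refine h1.congr_deriv ?_
    field_simp [hne z hz]
    ring
  have hconst : ∀ z ∈ ball (0 : ℂ) R, g z * Complex.exp (-h z) = g 0 * Complex.exp (-h 0) := by
    intro z hz
    refine isOpen_ball.is_const_of_deriv_eq_zero (convex_ball (0 : ℂ) R).isPreconnected
      (fun w hw => (hc w hw).differentiableAt.differentiableWithinAt)
      (fun w hw => (hc w hw).deriv) hz h0
  refine ⟨fun z => h z - h 0, fun z hz => ?_, by simp, fun z hz => ?_⟩
  · exact ((hh z hz).differentiableAt.sub_const _).differentiableWithinAt
  · have := hconst z hz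
    rw [Complex.exp_sub, mul_div_assoc', eq_div_iff (Complex.exp_ne_zero _)]
    rw [Complex.exp_neg, Complex.exp_neg] at this
    field_simp at this
    linear_combination this

/-- A second order Borel-Carathéodory inequality for an even combination. -/
lemma norm_add_comp_neg_le {h : ℂ → ℂ} {R K : ℝ} (hK : 0 < K)
    (hh : DifferentiableOn ℂ h (ball 0 R)) (h0 : h 0 = 0)
    (hre : ∀ z ∈ ball (0 : ℂ) R, (h z).re ≤ K) {x : ℂ} (hx : 2 * ‖x‖ ≤ R) (hR : 0 < R) :
    ‖h x + h (-x)‖ ≤ 6 * K * (‖x‖ / R) ^ 2 := by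
  have hmem0 : (0 : ℂ) ∈ ball (0 : ℂ) R := mem_ball_self hR
  have hneg : ∀ z ∈ ball (0 : ℂ) R, -z ∈ ball (0 : ℂ) R := fun z hz => by simpa using hz
  set H : ℂ → ℂ := fun z => h z + h (-z) with hH
  have hHd : DifferentiableOn ℂ H (ball 0 R) :=
    hh.add (hh.comp differentiable_neg.differentiableOn hneg)
  have hH0 : H 0 = 0 := by simp [hH, h0]
  have hHre : ∀ z ∈ ball (0 : ℂ) R, (H z).re ≤ 2 * K := fun z hz => by
    have h1 := hre z hz
    have h2 := hre _ (hneg z hz)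
    simp only [hH, Complex.add_re]
    linarith
  -- Evenness removes the linear term. The resulting double zero makes the final bound quadratic in
  -- `‖x‖ / R`.
  have hH' : HasDerivAt H 0 0 := by
    have h1 : HasDerivAt h (deriv h 0) 0 :=
      (hh.differentiableAt (isOpen_ball.mem_nhds hmem0)).hasDerivAt
    have h2 : HasDerivAt (fun z => h (-z)) (-deriv h 0) 0 := by
      have h1' : HasDerivAt h (deriv h 0) (-0) := by simpa using h1
      exact (h1'.comp (0 : ℂ) (hasDerivAt_neg (0 : ℂ))).congr_deriv (by ring)
    exact (h1.add h2).congr_deriv (by ring)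
  have hden : ∀ z ∈ ball (0 : ℂ) R, (4 * K : ℂ) - H z ≠ 0 := by
    intro z hz h
    have h1 := hHre z hz
    have h2 := congrArg Complex.re h
    simp at h2
    linarith
  -- A Möbius map taking the half-plane `re ≤ 2 * K` into the closed unit disc and fixing 0; the
  -- Schwarz lemma for a double zero applies to `W`.
  set W : ℂ → ℂ := fun z => H z / (4 * K - H z) with hW
  have hWd : DifferentiableOn ℂ W (ball 0 R) := hHd.div (hHd.const_sub _) hden
  have hW0 : W 0 = 0 := by simp [hW, hH0]
  have hW' : HasDerivAt W 0 0 := by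
    have := hH'.div (hH'.const_sub (4 * K : ℂ)) (hden 0 hmem0)
    exact this.congr_deriv (by simp [hH0])
  have hmaps : MapsTo W (ball 0 R) (closedBall (W 0) 1) := by
    intro z hz
    rw [hW0, mem_closedBall_zero_iff]
    simp only [hW, norm_div]
    refine div_le_one_of_le₀ ?_ (norm_nonneg _)
    rw [← sq_le_sq₀ (norm_nonneg _) (norm_nonneg _), Complex.sq_norm, Complex.sq_norm,
      Complex.normSq_apply, Complex.normSq_apply]
    have h1 := hHre z hz
    simp
    nlinarith
  have hxR : x ∈ ball (0 : ℂ) R := by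
    rw [mem_ball_zero_iff]
    rcases (norm_nonneg x).eq_or_lt with h | h <;> linarith
  have hlo : (W · - W 0) =o[𝓝 0] (fun w : ℂ => ‖w - 0‖ ^ 1) := by
    have := hasDerivAt_iff_isLittleO.1 hW'
    simp only [pow_one]
    exact isLittleO_norm_right.2 (by simpa using this)
  have hWx := Complex.dist_le_mul_div_pow_of_mapsTo_ball_of_isLittleO hWd hmaps hlo hxR
  rw [hW0, dist_zero_right, dist_zero_right, one_mul] at hWx
  norm_num at hWx
  have hq : (‖x‖ / R) ^ 2 ≤ 1 / 4 := by
    have h1 : ‖x‖ / R ≤ 1 / 2 := by rw [div_le_div_iff₀ hR two_pos]; linarith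
    have h2 : 0 ≤ ‖x‖ / R := by positivity
    nlinarith
  set q := (‖x‖ / R) ^ 2
  -- Inverting the Möbius map: since `‖W x‖ ≤ q ≤ 1 / 4`, the bound is `4 K q / (3 / 4)`, and `16 /
  -- 3 ≤ 6`.
  have hWH : H x * (1 + W x) = 4 * K * W x := by
    simp only [hW]
    field_simp [hden x hxR]
    ring
  have h1W : 3 / 4 ≤ ‖1 + W x‖ := by
    have := norm_sub_le_norm_add (1 : ℂ) (W x)
    simp at this
    linarith
  have hn : ‖H x‖ * ‖1 + W x‖ = 4 * K * ‖W x‖ := by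
    rw [← norm_mul, hWH]
    simp [abs_of_pos hK]
  have hHn := norm_nonneg (H x)
  have hWn := norm_nonneg (W x)
  change ‖H x‖ ≤ 6 * K * q
  nlinarith [mul_le_mul_of_nonneg_left h1W hHn, mul_le_mul_of_nonneg_left hWx hK.le]

/-- A finite form of Hadamard's factorization, at a pair of opposite points. -/
lemma norm_mul_norm_neg_le_prod {f : ℂ → ℂ} (hf : Differentiable ℂ f) (h0 : f 0 ≠ 0)
    {R K : ℝ} (hR : 0 < R) (hK : 0 < K) {S : Finset ℂ} (hS0 : ∀ a ∈ S, a ≠ 0)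
    (hSR : ∀ a ∈ S, ‖a‖ ≤ R) (hS : ∀ a ∈ ball (0 : ℂ) R, f a = 0 → a ∈ S)
    (hbound : ∀ z, ‖z‖ = 2 * R → ‖f z‖ ≤ ‖f 0‖ * Real.exp K) {x : ℂ} (hx : 2 * ‖x‖ ≤ R) :
    ‖f x‖ * ‖f (-x)‖ ≤ ‖f 0‖ ^ 2 * Real.exp (6 * K * (‖x‖ / R) ^ 2) *
      ∏ a ∈ S, ‖1 - (x / a) ^ 2‖ ^ analyticOrderNatAt f a := by
  obtain ⟨g, hg, hgS, hfg⟩ := exists_entire_eq_prod_mul hf h0 S hS0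
  have hg0 : g 0 = f 0 := by rw [hfg 0]; simp
  have hgne : ∀ z ∈ ball (0 : ℂ) R, g z ≠ 0 := by
    intro z hz h
    exact hgS z (hS z hz (by rw [hfg, h, mul_zero])) h
  -- On the circle of radius `2 * R` every factor has `‖1 - z / a‖ ≥ 1`, so division by them does
  -- not increase the bound; the maximum principle then carries it inside.
  have hgb : ∀ z, ‖z‖ = 2 * R → ‖g z‖ ≤ ‖f 0‖ * Real.exp K := by
    intro z hz
    refine le_trans ?_ (hbound z hz)
    rw [hfg z, norm_mul, norm_prod]
    refine le_mul_of_one_le_left (norm_nonneg _) 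
      (Finset.prod_induction _ (1 ≤ ·) (fun _ _ => one_le_mul_of_one_le_of_one_le) le_rfl
        fun a ha => ?_)
    rw [norm_pow]
    refine one_le_pow₀ ?_
    have ha0 : 0 < ‖a‖ := norm_pos_iff.2 (hS0 a ha)
    have h2 : 2 ≤ ‖z / a‖ := by
      rw [norm_div, hz, le_div_iff₀ ha0]
      linarith [hSR a ha]
    have := norm_sub_norm_le (z / a) 1
    rw [norm_one, norm_sub_rev] at this
    linarith
  have hgball : ∀ z ∈ ball (0 : ℂ) R, ‖g z‖ ≤ ‖f 0‖ * Real.exp K := by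
    intro z hz
    refine Complex.norm_le_of_forall_mem_frontier_norm_le (U := ball (0 : ℂ) (2 * R))
      isBounded_ball hg.diffContOnCl (fun w hw => ?_) (subset_closure ?_)
    · rw [frontier_ball _ (by positivity)] at hw
      exact hgb w (by simpa using hw)
    · exact ball_subset_ball (by linarith) hz
  obtain ⟨h, hh, hh0, hgh⟩ := exists_log_on_ball hR hg.differentiableOn hgne
  have hf0 : 0 < ‖f 0‖ := norm_pos_iff.2 h0
  have hre : ∀ z ∈ ball (0 : ℂ) R, (h z).re ≤ K := by
    intro z hz
    have h1 := hgball z hz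
    rw [hgh z hz, norm_mul, hg0, Complex.norm_exp] at h1
    exact Real.exp_le_exp.1 (le_of_mul_le_mul_left h1 hf0)
  have hH := norm_add_comp_neg_le hK hh hh0 hre hx hR
  have hxR : x ∈ ball (0 : ℂ) R := by
    rw [mem_ball_zero_iff]
    rcases (norm_nonneg x).eq_or_lt with h | h <;> linarith
  have hxR' : -x ∈ ball (0 : ℂ) R := by simpa using hxR
  have hgg : ‖g x‖ * ‖g (-x)‖ ≤ ‖f 0‖ ^ 2 * Real.exp (6 * K * (‖x‖ / R) ^ 2) := by
    rw [hgh x hxR, hgh _ hxR', hg0, norm_mul, norm_mul, mul_mul_mul_comm, ← norm_mul,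
      ← norm_mul, ← Complex.exp_add, norm_mul, ← sq, Complex.norm_exp]
    gcongr
    exact (Complex.re_le_norm _).trans hH
  have hprod : ‖f x‖ * ‖f (-x)‖ =
      (∏ a ∈ S, ‖1 - (x / a) ^ 2‖ ^ analyticOrderNatAt f a) * (‖g x‖ * ‖g (-x)‖) := by
    rw [hfg x, hfg (-x), norm_mul, norm_mul, norm_prod, norm_prod, mul_mul_mul_comm,
      ← Finset.prod_mul_distrib]
    congr 1
    refine Finset.prod_congr rfl fun a _ => ?_
    rw [norm_pow, norm_pow, ← mul_pow, ← norm_mul]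
    congr 2
    ring
  rw [hprod, mul_comm]
  gcongr

end ZetaPairs

/-! ### The entire function `xi`: symmetry, zeros and growth. -/

namespace ZetaPairs

open Filter Topology Asymptotics Metric Set HurwitzZeta

/-- The entire function `s (s - 1) Λ(s)` in the variable `z = s - 1/2`, in which it is even. -/
noncomputable def xi (z : ℂ) : ℂ :=
  (1 / 2 + z) * (z - 1 / 2) * completedRiemannZeta₀ (1 / 2 + z) + 1

lemma differentiable_xi : Differentiable ℂ xi := by
  have := differentiable_completedZeta₀
  unfold xi
  fun_prop

lemma xi_neg (z : ℂ) : xi (-z) = xi z := by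
  have : completedRiemannZeta₀ (1 / 2 + -z) = completedRiemannZeta₀ (1 / 2 + z) := by
    rw [← completedRiemannZeta₀_one_sub]
    congr 1
    ring
  simp only [xi, this]
  ring

lemma xi_sub_half {s : ℂ} (h0 : s ≠ 0) (h1 : s ≠ 1) :
    xi (s - 1 / 2) = s * (s - 1) * completedRiemannZeta s := by
  have h1' : 1 - s ≠ 0 := sub_ne_zero.2 h1.symm
  rw [completedRiemannZeta_eq, xi]
  rw [show (1 / 2 : ℂ) + (s - 1 / 2) = s by ring, show s - 1 / 2 - 1 / 2 = s - 1 by ring]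
  field_simp
  ring

lemma mul_riemannZeta_eq {s : ℂ} (h0 : s ≠ 0) (h1 : s ≠ 1) :
    s * (s - 1) * riemannZeta s = xi (s - 1 / 2) * (Complex.Gammaℝ s)⁻¹ := by
  rw [xi_sub_half h0 h1, riemannZeta_def_of_ne_zero h0]
  ring

lemma xi_sub_half_eq_mul_riemannZeta {s : ℂ} (h0 : 0 < s.re) (h1 : s ≠ 1) :
    xi (s - 1 / 2) = s * (s - 1) * Complex.Gammaℝ s * riemannZeta s := by
  have hs0 : s ≠ 0 := by rintro rfl; simp at h0
  have := mul_riemannZeta_eq hs0 h1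
  have hG := Complex.Gammaℝ_ne_zero_of_re_pos h0
  rw [eq_mul_inv_iff_mul_eq₀ hG] at this
  linear_combination -this

lemma xi_half : xi (1 / 2) = 1 := by simp [xi]

/-- Zeta and `Gammaℝ` do not vanish for `1 ≤ re s`. The point `s = 1`, where the product formula
fails, is covered by `xi_half`. -/
lemma re_lt_half_of_xi_eq_zero {z : ℂ} (h : xi z = 0) : z.re < 1 / 2 := by
  by_contra! hre
  have hz : z = (1 / 2 + z) - 1 / 2 := by ring
  have hre' : 1 ≤ (1 / 2 + z).re := by simp; linarith
  have hne1 : (1 / 2 + z) ≠ 1 := by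
    intro h1
    have : z = 1 / 2 := by linear_combination h1
    rw [this, xi_half] at h
    exact one_ne_zero h
  have hne0 : (1 / 2 + z) ≠ 0 := by
    intro h0
    rw [h0] at hre'
    simp at hre'
    linarith
  rw [hz, xi_sub_half_eq_mul_riemannZeta (by linarith) hne1] at h
  have := Complex.Gammaℝ_ne_zero_of_re_pos (s := 1 / 2 + z) (by linarith)
  have h2 := riemannZeta_ne_zero_of_one_le_re hre'
  have h3 := sub_ne_zero.2 hne1
  exact mul_ne_zero (mul_ne_zero (mul_ne_zero hne0 h3) this) h2 h

/-- The zeros of `xi` are the shifted nontrivial zeros of `ζ`. -/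
lemma strip_of_xi_eq_zero {z : ℂ} (h : xi z = 0) :
    riemannZeta (1 / 2 + z) = 0 ∧ 0 < (1 / 2 + z).re ∧ (1 / 2 + z).re < 1 := by
  have h1 := re_lt_half_of_xi_eq_zero h
  have h2 := re_lt_half_of_xi_eq_zero (z := -z) (by rw [xi_neg, h])
  have hre : (1 / 2 + z).re = 1 / 2 + z.re := by simp
  have hn : (-z).re = -z.re := Complex.neg_re z
  have hne1 : (1 / 2 + z) ≠ 1 := by
    intro h
    rw [h, Complex.one_re] at hre
    linarith
  have hne0 : (1 / 2 + z) ≠ 0 := by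
    intro h
    rw [h, Complex.zero_re] at hre
    linarith
  refine ⟨?_, by linarith, by linarith⟩
  have h3 := mul_riemannZeta_eq hne0 hne1
  rw [show (1 / 2 + z) - 1 / 2 = z by ring, h, zero_mul] at h3
  exact (mul_eq_zero.1 h3).resolve_left (mul_ne_zero hne0 (sub_ne_zero.2 hne1))

/-- The factors `s (s - 1)` and `1 / Gammaℝ s` are analytic and nonzero at such a point, so they do
not affect the order. -/
lemma analyticOrderAt_xi {z : ℂ} (h0 : 0 < (1 / 2 + z).re) (h1 : 1 / 2 + z ≠ 1) :
    analyticOrderAt xi z = analyticOrderAt riemannZeta (1 / 2 + z) := by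
  set s := 1 / 2 + z with hs
  have hs0 : s ≠ 0 := by intro h; simp [h] at h0
  have hz : z = s - 1 / 2 := by rw [hs]; ring
  have hcomp : analyticOrderAt (xi ∘ fun w => w - 1 / 2) s = analyticOrderAt xi (s - 1 / 2) :=
    analyticOrderAt_comp_of_deriv_ne_zero (by fun_prop) (by simp)
  have hpoly : Differentiable ℂ fun w : ℂ => w * (w - 1) := by fun_prop
  have hxi : Differentiable ℂ (xi ∘ fun w => w - 1 / 2) :=
    differentiable_xi.comp (by fun_prop)
  have heq : ((fun w : ℂ => w * (w - 1)) * riemannZeta) =ᶠ[𝓝 s]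
      ((xi ∘ fun w => w - 1 / 2) * fun w => (Complex.Gammaℝ w)⁻¹) := by
    filter_upwards [isOpen_ne.mem_nhds hs0, isOpen_ne.mem_nhds h1] with w hw0 hw1
    exact mul_riemannZeta_eq hw0 hw1
  have hord := analyticOrderAt_congr heq
  rw [analyticOrderAt_mul (hpoly.analyticAt s) (analyticAt_riemannZeta h1),
    analyticOrderAt_mul (hxi.analyticAt s) (Complex.differentiable_Gammaℝ_inv.analyticAt s),
    (hpoly.analyticAt s).analyticOrderAt_eq_zero.2 (mul_ne_zero hs0 (sub_ne_zero.2 h1)),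
    (Complex.differentiable_Gammaℝ_inv.analyticAt s).analyticOrderAt_eq_zero.2
      (inv_ne_zero (Complex.Gammaℝ_ne_zero_of_re_pos h0)), zero_add, add_zero, hcomp, ← hz] at hord
  exact hord.symm

lemma analyticOrderNatAt_xi {z : ℂ} (h : xi z = 0) :
    analyticOrderNatAt xi z = mult (1 / 2 + z) := by
  obtain ⟨-, h1, h2⟩ := strip_of_xi_eq_zero h
  rw [mult, analyticOrderNatAt, analyticOrderAt_xi h1, analyticOrderNatAt]
  intro h
  rw [h, Complex.one_re] at h2
  exact lt_irrefl _ h2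

lemma analyticOrderNatAt_xi_neg (z : ℂ) :
    analyticOrderNatAt xi (-z) = analyticOrderNatAt xi z := by
  have : analyticOrderAt (xi ∘ fun w => -w) z = analyticOrderAt xi (-z) :=
    analyticOrderAt_comp_of_deriv_ne_zero (by fun_prop) (by simp)
  rw [show (xi ∘ fun w => -w) = xi from funext xi_neg] at this
  rw [analyticOrderNatAt, ← this, analyticOrderNatAt]

/-! ### Growth of `xi` -/

lemma one_le_evenKernel_zero {t : ℝ} (ht : 0 < t) : 1 ≤ evenKernel 0 t := by
  have h := hasSum_int_evenKernel 0 ht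
  have := le_hasSum h 0 fun j _ => (Real.exp_pos _).le
  simpa using this

/-- The function whose Mellin transform is `Λ₀` is nonnegative. -/
lemma exists_nonneg_eq_f_modif {t : ℝ} (ht : 0 < t) :
    ∃ r : ℝ, 0 ≤ r ∧ (hurwitzEvenFEPair 0).f_modif t = (r : ℂ) := by
  rcases lt_trichotomy t 1 with h | rfl | h
  · refine ⟨evenKernel 0 t - t ^ (-(1 / 2 : ℝ)), ?_, ?_⟩
    -- Theta inversion: the kernel at `t` is `t ^ (-1/2)` times its value at `1 / t`, which is at
    -- least 1.
    · rw [evenKernel_functional_equation, ← evenKernel_eq_cosKernel_of_zero, Real.rpow_neg ht.le,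
        sub_nonneg, one_div (t ^ (1 / 2 : ℝ))]
      exact le_mul_of_one_le_right (by positivity) (one_le_evenKernel_zero (by positivity))
    · have h' : ¬ 1 < t := h.le.not_gt
      simp [WeakFEPair.f_modif, hurwitzEvenFEPair, h, ht, h']
  · exact ⟨0, le_rfl, by simp [WeakFEPair.f_modif]⟩
  · refine ⟨evenKernel 0 t - 1, sub_nonneg.2 (one_le_evenKernel_zero ht), ?_⟩
    simp [WeakFEPair.f_modif, hurwitzEvenFEPair, h, h.le.not_gt]

lemma norm_mellin_le_of_nonneg {f : ℝ → ℂ} (hf : ∀ t, 0 < t → ∃ r : ℝ, 0 ≤ r ∧ f t = (r : ℂ))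
    (s : ℂ) : ‖mellin f s‖ ≤ ‖mellin f (s.re : ℂ)‖ := by
  have h1 : mellin f (s.re : ℂ) =
      ((∫ t : ℝ in Ioi 0, ‖(t : ℂ) ^ (s - 1) • f t‖ : ℝ) : ℂ) := by
    rw [mellin, ← integral_complex_ofReal]
    refine MeasureTheory.setIntegral_congr_fun measurableSet_Ioi fun t (ht : 0 < t) => ?_
    obtain ⟨r, hr, hrf⟩ := hf t ht
    simp only [hrf, smul_eq_mul, norm_mul, Complex.norm_cpow_eq_rpow_re_of_pos ht,
      Complex.norm_real, Real.norm_of_nonneg hr, Complex.sub_re, Complex.one_re]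
    rw [Complex.ofReal_mul, Complex.ofReal_cpow ht.le]
    simp
  rw [h1, Complex.norm_real]
  exact (MeasureTheory.norm_integral_le_integral_norm _).trans (le_abs_self _)

/-- The Mellin transform of a nonnegative function is largest in norm on the real axis, so growth
only has to be checked there. -/
lemma norm_completedRiemannZeta₀_le (s : ℂ) :
    ‖completedRiemannZeta₀ s‖ ≤ ‖completedRiemannZeta₀ (s.re : ℂ)‖ := by
  have h := norm_mellin_le_of_nonneg (fun t ht => exists_nonneg_eq_f_modif ht) (s / 2)
  have hre : ((s / 2).re : ℂ) = (s.re : ℂ) / 2 := by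
    rw [show (s / 2).re = s.re / 2 by simp]
    push_cast
    ring
  rw [hre] at h
  have he : ∀ w, completedRiemannZeta₀ w = mellin (hurwitzEvenFEPair 0).f_modif (w / 2) / 2 :=
    fun w => rfl
  rw [he, he, norm_div, norm_div]
  gcongr

lemma exists_norm_riemannZeta_le :
    ∃ B : ℝ, 0 < B ∧ ∀ s : ℂ, 2 ≤ s.re → ‖riemannZeta s‖ ≤ B := by
  have hsum : Summable fun n : ℕ => 1 / ((n : ℝ) + 1) ^ (2 : ℝ) := by
    have := (Real.summable_one_div_nat_rpow (p := 2)).2 one_lt_two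
    simpa using (summable_nat_add_iff 1).2 this
  refine ⟨∑' n : ℕ, 1 / ((n : ℝ) + 1) ^ (2 : ℝ), hsum.tsum_pos (fun n => by positivity) 0 (by simp),
    fun s hs => ?_⟩
  rw [zeta_eq_tsum_one_div_nat_add_one_cpow (by linarith)]
  refine tsum_of_norm_bounded hsum.hasSum fun n => ?_
  have : ((n : ℂ) + 1) = (((n : ℝ) + 1 : ℝ) : ℂ) := by push_cast; rfl
  rw [norm_div, norm_one, this, Complex.norm_cpow_eq_rpow_re_of_pos (by positivity)]
  gcongr
  linarith [n.cast_nonneg (α := ℝ)]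

/-- Deliberately crude: any growth exponent below 2 suffices later, and bounding the logarithm by a
square root gives 3/2. -/
lemma Gamma_le_exp {y : ℝ} (hy : 2 ≤ y) : Real.Gamma y ≤ Real.exp (2 * ((y + 1) * √(y + 1))) := by
  have hc := Nat.ceil_lt_add_one (show 0 ≤ y by linarith)
  have hc' := Nat.le_ceil y
  have hn : (1 : ℝ) ≤ ⌈y⌉₊ := by linarith
  calc Real.Gamma y ≤ Real.Gamma (⌈y⌉₊ + 1) :=
        Real.Gamma_strictMonoOn_Ici.monotoneOn hy (show (2 : ℝ) ≤ _ by linarith) (by linarith)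
    _ ≤ (⌈y⌉₊ : ℝ) ^ ⌈y⌉₊ := by
        rw [Real.Gamma_nat_eq_factorial]
        exact_mod_cast Nat.factorial_le_pow _
    _ = Real.exp (⌈y⌉₊ * Real.log ⌈y⌉₊) := by
        rw [mul_comm, ← Real.rpow_def_of_pos (by linarith), Real.rpow_natCast]
    _ ≤ Real.exp ((y + 1) * (2 * √(y + 1))) := by
        have hl : Real.log ⌈y⌉₊ ≤ 2 * √(y + 1) := by
          have h1 : Real.log ⌈y⌉₊ ≤ Real.log (y + 1) := Real.log_le_log (by linarith) hc.le
          have h2 := Real.log_le_self (Real.sqrt_nonneg (y + 1))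
          rw [Real.log_sqrt (by linarith)] at h2
          linarith
        have := Real.log_nonneg hn
        gcongr
    _ = _ := by ring_nf

lemma norm_Gammaℝ_ofReal {σ : ℝ} (hσ : 0 < σ) :
    ‖Complex.Gammaℝ (σ : ℂ)‖ = Real.pi ^ (-σ / 2) * Real.Gamma (σ / 2) := by
  rw [Complex.Gammaℝ_def, norm_mul, Complex.norm_cpow_eq_rpow_re_of_pos Real.pi_pos]
  have : ((σ : ℂ) / 2) = ((σ / 2 : ℝ) : ℂ) := by push_cast; rfl
  rw [this, Complex.Gamma_ofReal, Complex.norm_real,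
    Real.norm_of_nonneg (Real.Gamma_pos_of_pos (by positivity)).le]
  congr 2
  simp

lemma exists_norm_completedRiemannZeta₀_ofReal_le :
    ∃ B : ℝ, 1 ≤ B ∧ ∀ σ : ℝ, 1 / 2 ≤ σ →
      ‖completedRiemannZeta₀ (σ : ℂ)‖ ≤ B * Real.exp (2 * ((σ + 1) * √(σ + 1))) := by
  obtain ⟨B₁, hB₁, hζ⟩ := exists_norm_riemannZeta_le
  have hcont : Continuous fun σ : ℝ => completedRiemannZeta₀ (σ : ℂ) :=
    differentiable_completedZeta₀.continuous.comp Complex.continuous_ofReal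
  obtain ⟨B₂, hB₂⟩ := (isCompact_Icc (a := (1 / 2 : ℝ)) (b := 4)).exists_bound_of_continuousOn
    hcont.continuousOn
  refine ⟨B₁ + |B₂| + 2, by linarith [abs_nonneg B₂], fun σ hσ => ?_⟩
  have hexp : 1 ≤ Real.exp (2 * ((σ + 1) * √(σ + 1))) := by
    apply Real.one_le_exp
    have : 0 ≤ σ + 1 := by linarith
    positivity
  rcases le_total σ 4 with h4 | h4
  · have := hB₂ σ ⟨hσ, h4⟩
    have h2 := le_abs_self B₂
    nlinarith [abs_nonneg B₂]
  · have hs0 : (σ : ℂ) ≠ 0 := by exact_mod_cast (by linarith : σ ≠ 0)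
    have hΛ : completedRiemannZeta₀ (σ : ℂ) =
        Complex.Gammaℝ σ * riemannZeta σ + 1 / σ + 1 / (1 - σ) := by
      rw [riemannZeta_def_of_ne_zero hs0, completedRiemannZeta_eq,
        mul_div_cancel₀ _ (Complex.Gammaℝ_ne_zero_of_re_pos (by simp; linarith))]
      ring
    have hG : ‖Complex.Gammaℝ (σ : ℂ)‖ ≤ Real.exp (2 * ((σ + 1) * √(σ + 1))) := by
      rw [norm_Gammaℝ_ofReal (by linarith)]
      have h1 : Real.pi ^ (-σ / 2) ≤ 1 :=
        Real.rpow_le_one_of_one_le_of_nonpos (by linarith [Real.pi_gt_three]) (by linarith)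
      have h2 : Real.Gamma (σ / 2) ≤ Real.exp (2 * ((σ + 1) * √(σ + 1))) := by
        refine (Gamma_le_exp (by linarith)).trans (Real.exp_le_exp.2 ?_)
        gcongr <;> linarith
      exact (mul_le_of_le_one_left (Real.Gamma_pos_of_pos (by linarith)).le h1).trans h2
    have h1 : ‖(1 / σ : ℂ)‖ ≤ 1 := by
      rw [norm_div, norm_one, Complex.norm_real, Real.norm_of_nonneg (by linarith)]
      exact div_le_one_of_le₀ (by linarith) (by linarith)
    have h2 : ‖(1 / (1 - σ) : ℂ)‖ ≤ 1 := by
      rw [norm_div, norm_one, ← Complex.ofReal_one, ← Complex.ofReal_sub, Complex.norm_real,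
        Real.norm_eq_abs, abs_of_nonpos (by linarith)]
      exact div_le_one_of_le₀ (by linarith) (by linarith)
    have h3 := hζ σ (by simp; linarith)
    rw [hΛ]
    refine (norm_add₃_le).trans ?_
    rw [norm_mul]
    have h4 := mul_le_mul hG h3 (norm_nonneg _) (Real.exp_pos _).le
    nlinarith [abs_nonneg B₂]

lemma exists_norm_xi_le :
    ∃ C : ℝ, 0 < C ∧ ∀ z : ℂ, ‖xi z‖ ≤ Real.exp (C * ((‖z‖ + 2) * √(‖z‖ + 2))) := by
  obtain ⟨B, hB, hΛ⟩ := exists_norm_completedRiemannZeta₀_ofReal_le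
  have main : ∀ z : ℂ, 0 ≤ z.re →
      ‖xi z‖ ≤ Real.exp ((B + 5) * ((‖z‖ + 2) * √(‖z‖ + 2))) := by
    intro z hz
    set w := ‖z‖ + 2 with hw
    have hw2 : 2 ≤ w := by linarith [norm_nonneg z]
    have hsq : 1 ≤ √w := Real.one_le_sqrt.2 (by linarith)
    have hE : w ≤ w * √w := le_mul_of_one_le_right (by linarith) hsq
    set E := w * √w
    have hre : ((1 : ℂ) / 2 + z).re = 1 / 2 + z.re := by simp
    have hzre : z.re ≤ ‖z‖ := Complex.re_le_norm z
    have h1 : ‖completedRiemannZeta₀ (1 / 2 + z)‖ ≤ B * Real.exp (2 * E) := by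
      refine (norm_completedRiemannZeta₀_le _).trans ?_
      rw [hre]
      refine (hΛ _ (by linarith)).trans ?_
      have : 1 / 2 + z.re + 1 ≤ w := by linarith
      gcongr
      exact mul_le_mul this (Real.sqrt_le_sqrt this) (Real.sqrt_nonneg _) (by linarith)
    have h2 : ‖(1 : ℂ) / 2 + z‖ ≤ w := (norm_add_le _ _).trans (by norm_num; linarith)
    have h3 : ‖z - 1 / 2‖ ≤ w := (norm_sub_le _ _).trans (by norm_num; linarith)
    have hwexp : w ≤ Real.exp E := hE.trans ((Real.add_one_le_exp E).trans' (by linarith))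
    have hBexp : B ≤ Real.exp (B * E) := by
      refine le_trans ?_ ((Real.add_one_le_exp _).trans' (le_add_of_nonneg_right zero_le_one))
      exact le_mul_of_one_le_right (by linarith) (by linarith)
    calc ‖xi z‖ ≤ ‖(1 : ℂ) / 2 + z‖ * ‖z - 1 / 2‖ * ‖completedRiemannZeta₀ (1 / 2 + z)‖ + 1 := by
          refine (norm_add_le _ _).trans ?_
          rw [norm_mul, norm_mul, norm_one]
      _ ≤ Real.exp E * Real.exp E * (Real.exp (B * E) * Real.exp (2 * E)) + 1 := by
          gcongr
          · exact h2.trans hwexp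
          · exact h3.trans hwexp
          · exact h1.trans (by gcongr)
      _ = Real.exp ((B + 4) * E) + 1 := by
          rw [← Real.exp_add, ← Real.exp_add, ← Real.exp_add]
          ring_nf
      _ ≤ Real.exp ((B + 4) * E) * Real.exp E := by
          have h5 : 1 ≤ Real.exp ((B + 4) * E) := Real.one_le_exp (by positivity)
          have h6 : 2 ≤ Real.exp E := hw2.trans hwexp
          nlinarith
      _ = Real.exp ((B + 5) * E) := by
          rw [← Real.exp_add]
          ring_nf
  refine ⟨B + 5, by linarith, fun z => ?_⟩
  rcases le_total 0 z.re with h | h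
  · exact main z h
  · have := main (-z) (by simpa using h)
    rwa [xi_neg, norm_neg] at this

end ZetaPairs

namespace ZetaPairs

open Filter Topology Asymptotics Metric Set

/-! ### Lower bound for `xi` on the positive real axis -/

lemma one_le_norm_riemannZeta_ofReal {σ : ℝ} (hσ : 1 < σ) : 1 ≤ ‖riemannZeta (σ : ℂ)‖ := by
  have hsum : Summable fun n : ℕ => 1 / ((n : ℝ) + 1) ^ σ := by
    have := (Real.summable_one_div_nat_rpow (p := σ)).2 hσ
    simpa using (summable_nat_add_iff 1).2 this
  have h : riemannZeta (σ : ℂ) = ((∑' n : ℕ, 1 / ((n : ℝ) + 1) ^ σ : ℝ) : ℂ) := by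
    rw [zeta_eq_tsum_one_div_nat_add_one_cpow (by simpa using hσ), Complex.ofReal_tsum]
    refine tsum_congr fun n => ?_
    rw [Complex.ofReal_div, Complex.ofReal_cpow (by positivity)]
    push_cast
    rfl
  rw [h, Complex.norm_real]
  refine le_trans ?_ (le_abs_self _)
  have := hsum.le_tsum 0 fun n _ => by positivity
  simpa using this

/-- Compare with the factorial of `n = ⌊y⌋₊ - 1` and use `n ! ≥ (n / e) ^ n`. Here `n > x / 2 - 2`,
and `8 ≤ x` ensures `n ≥ x / 4`. -/
lemma le_log_Gamma {x : ℝ} (hx : 8 ≤ x) :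
    x / 2 * Real.log x - 4 * x ≤ Real.log (Real.Gamma ((1 / 2 + x) / 2)) := by
  set y := (1 / 2 + x) / 2 with hy
  obtain ⟨n, hn⟩ : ∃ n : ℕ, ⌊y⌋₊ = n + 1 :=
    Nat.exists_eq_succ_of_ne_zero (Nat.floor_pos.2 (by linarith)).ne'
  have hfl : (n : ℝ) + 1 ≤ y := by
    have := Nat.floor_le (show 0 ≤ y by linarith)
    rw [hn] at this
    exact_mod_cast this
  have hfl' : y < (n : ℝ) + 2 := by
    have := Nat.lt_floor_add_one y
    rw [hn] at this
    push_cast at this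
    linarith
  have hn4 : x / 4 ≤ n := by linarith
  have hn0 : (0 : ℝ) < n := by linarith
  have h1 : Real.log (n.factorial : ℝ) ≤ Real.log (Real.Gamma y) := by
    have hf : (0 : ℝ) < n.factorial := by exact_mod_cast n.factorial_pos
    refine Real.log_le_log hf ?_
    rw [← Real.Gamma_nat_eq_factorial]
    exact Real.Gamma_strictMonoOn_Ici.monotoneOn (show (2 : ℝ) ≤ _ by linarith)
      (show (2 : ℝ) ≤ _ by linarith) hfl
  have h2 : n * Real.log n - n ≤ Real.log (n.factorial : ℝ) := by
    have hf : (0 : ℝ) < n.factorial := by exact_mod_cast n.factorial_pos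
    have h := Real.log_le_log (by positivity) (Real.pow_div_factorial_le_exp (n : ℝ) n.cast_nonneg n)
    rw [Real.log_exp, Real.log_div (by positivity) hf.ne', Real.log_pow] at h
    linarith
  have h3 : Real.log x - Real.log 4 ≤ Real.log n := by
    rw [← Real.log_div (by linarith) (by norm_num)]
    exact Real.log_le_log (by linarith) hn4
  have h4 : 0 ≤ Real.log x - Real.log 4 :=
    sub_nonneg.2 (Real.log_le_log (by norm_num) (by linarith))
  have h5 : Real.log 4 ≤ 2 := by
    rw [show (4 : ℝ) = 2 ^ 2 by norm_num, Real.log_pow]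
    have := Real.log_two_lt_d9
    push_cast
    linarith
  have h6 : Real.log x ≤ x - 1 := Real.log_le_sub_one_of_pos (by linarith)
  have h7 : (x / 2 - 2) * (Real.log x - Real.log 4) ≤ n * Real.log n :=
    mul_le_mul (by linarith) h3 h4 hn0.le
  nlinarith

lemma log_norm_xi_ge {x : ℝ} (hx : 8 ≤ x) :
    x / 2 * Real.log x - 6 * x ≤ Real.log ‖xi (x : ℂ)‖ := by
  have hs : ((1 / 2 + x : ℝ) : ℂ) - 1 / 2 = x := by push_cast; ring
  have hre : ((1 / 2 + x : ℝ) : ℂ).re = 1 / 2 + x := Complex.ofReal_re _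
  have h1 : ((1 / 2 + x : ℝ) : ℂ) ≠ 1 := by
    intro h
    rw [h, Complex.one_re] at hre
    linarith
  rw [← hs, xi_sub_half_eq_mul_riemannZeta (by rw [hre]; linarith) h1, norm_mul, norm_mul,
    norm_Gammaℝ_ofReal (by linarith)]
  set s := 1 / 2 + x with hsdef
  have hpoly : 1 ≤ ‖(s : ℂ) * (s - 1)‖ := by
    rw [← Complex.ofReal_one, ← Complex.ofReal_sub, ← Complex.ofReal_mul, Complex.norm_real]
    exact le_trans (by nlinarith) (le_abs_self _)
  have hζ := one_le_norm_riemannZeta_ofReal (σ := s) (by linarith)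
  have hG : 0 < Real.Gamma (s / 2) := Real.Gamma_pos_of_pos (by linarith)
  have hπ : 0 < Real.pi ^ (-s / 2) := Real.rpow_pos_of_pos Real.pi_pos _
  rw [Real.log_mul (by positivity) (by positivity), Real.log_mul (by positivity) (by positivity),
    Real.log_mul hπ.ne' hG.ne', Real.log_rpow Real.pi_pos]
  have h2 := Real.log_nonneg hpoly
  have h3 := Real.log_nonneg hζ
  have h4 := le_log_Gamma hx
  have h5 : Real.log Real.pi ≤ 3 := by
    have := Real.log_le_sub_one_of_pos Real.pi_pos
    linarith [Real.pi_lt_four]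
  have h6 : -(2 * x) ≤ -s / 2 * Real.log Real.pi := by
    have : s / 2 * Real.log Real.pi ≤ s / 2 * 3 := by gcongr
    linarith
  linarith

/-! ### The inequality between `xi` and its zeros -/

lemma finite_zeros_xi (R : ℝ) : {a : ℂ | a ≠ 0 ∧ xi a = 0 ∧ ‖a‖ ≤ R}.Finite := by
  have hfin := (isCompact_closedBall (1 / 2 : ℂ) R).inter_riemannZetaZeros_finite
  refine (hfin.image fun s => s - 1 / 2).subset ?_
  rintro a ⟨-, ha, haR⟩
  refine ⟨1 / 2 + a, ⟨?_, (strip_of_xi_eq_zero ha).1⟩, by simp⟩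
  simpa [dist_eq_norm] using haR

/-- The nonzero zeros of `xi` of modulus at most `R`. -/
noncomputable def xiZeros (R : ℝ) : Finset ℂ := (finite_zeros_xi R).toFinset

lemma mem_xiZeros {R : ℝ} {a : ℂ} : a ∈ xiZeros R ↔ a ≠ 0 ∧ xi a = 0 ∧ ‖a‖ ≤ R := by
  simp [xiZeros]

lemma sum_le_sum_of_injOn {ι κ : Type*} {s : Finset ι} {t : Finset κ} {F : ι → ℝ} {G : κ → ℝ}
    (e : ι → κ) (he : ∀ i ∈ s, e i ∈ t) (hinj : Function.Injective e)
    (hFG : ∀ i ∈ s, F i ≤ G (e i)) (hG : ∀ k ∈ t, 0 ≤ G k) :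
    ∑ i ∈ s, F i ≤ ∑ k ∈ t, G k := by
  classical
  calc ∑ i ∈ s, F i ≤ ∑ i ∈ s, G (e i) := Finset.sum_le_sum hFG
    _ = ∑ k ∈ s.image e, G k := (Finset.sum_image fun _ _ _ _ h => hinj h).symm
    _ ≤ ∑ k ∈ t, G k := Finset.sum_le_sum_of_subset_of_nonneg
        (Finset.image_subset_iff.2 he) fun k hk _ => hG k hk

lemma log_one_add_sq_div_nonneg (x c : ℝ) : 0 ≤ Real.log (1 + x ^ 2 / c ^ 2) :=
  Real.log_nonneg (le_add_of_nonneg_right (by positivity))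

lemma log_one_add_sq_div_norm_le {a : ℂ} (x : ℝ) (ha : a.im ≠ 0) :
    Real.log (1 + x ^ 2 / ‖a‖ ^ 2) ≤ Real.log (1 + x ^ 2 / a.im ^ 2) := by
  have h1 : 0 < a.im ^ 2 := by positivity
  have h2 : a.im ^ 2 ≤ ‖a‖ ^ 2 := by
    rw [sq_le_sq, abs_norm]
    exact Complex.abs_im_le_norm a
  refine Real.log_le_log (by positivity) ?_
  gcongr

lemma sum_xiZeros_im_pos_le (x R : ℝ) :
    ∑ a ∈ xiZeros R with 0 < a.im,
        (analyticOrderNatAt xi a : ℝ) * Real.log (1 + x ^ 2 / ‖a‖ ^ 2) ≤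
      ∑ ρ ∈ zerosUpTo R, (mult ρ : ℝ) * Real.log (1 + x ^ 2 / ρ.im ^ 2) := by
  refine sum_le_sum_of_injOn (fun a => 1 / 2 + a) (fun a ha => ?_) (add_right_injective _)
    (fun a ha => ?_) fun ρ _ => mul_nonneg (Nat.cast_nonneg _) (log_one_add_sq_div_nonneg _ _)
  · obtain ⟨ha, him⟩ := Finset.mem_filter.1 ha
    obtain ⟨-, h0, hR⟩ := mem_xiZeros.1 ha
    obtain ⟨h1, h2, h3⟩ := strip_of_xi_eq_zero h0
    refine mem_zerosUpTo.2 ⟨h1, h2, h3, by simpa using him, ?_⟩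
    simpa using (Complex.im_le_norm a).trans hR
  · obtain ⟨ha, him⟩ := Finset.mem_filter.1 ha
    obtain ⟨-, h0, hR⟩ := mem_xiZeros.1 ha
    rw [analyticOrderNatAt_xi h0]
    refine mul_le_mul_of_nonneg_left ?_ (Nat.cast_nonneg _)
    simpa using log_one_add_sq_div_norm_le x him.ne'

lemma sum_xiZeros_im_neg_le (x R : ℝ) :
    ∑ a ∈ xiZeros R with a.im < 0,
        (analyticOrderNatAt xi a : ℝ) * Real.log (1 + x ^ 2 / ‖a‖ ^ 2) ≤
      ∑ ρ ∈ zerosUpTo R, (mult ρ : ℝ) * Real.log (1 + x ^ 2 / ρ.im ^ 2) := by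
  refine (sum_le_sum_of_injOn (fun a => -a) (fun a ha => ?_) neg_injective
    (fun a ha => ?_) fun a _ => mul_nonneg (Nat.cast_nonneg _)
      (log_one_add_sq_div_nonneg _ _)).trans (sum_xiZeros_im_pos_le x R)
  · obtain ⟨ha, him⟩ := Finset.mem_filter.1 ha
    obtain ⟨h1, h0, hR⟩ := mem_xiZeros.1 ha
    exact Finset.mem_filter.2 ⟨mem_xiZeros.2 ⟨neg_ne_zero.2 h1, by rw [xi_neg, h0],
      by rwa [norm_neg]⟩, by simpa using him⟩
  · rw [analyticOrderNatAt_xi_neg, norm_neg]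

lemma log_one_add_sq_le {u : ℝ} (hu : 0 ≤ u) : Real.log (1 + u ^ 2) ≤ 2 * u := by
  have h : Real.log (1 + u ^ 2) ≤ Real.log ((1 + u) ^ 2) :=
    Real.log_le_log (by positivity) (by nlinarith)
  rw [Real.log_pow] at h
  have h2 := Real.log_le_sub_one_of_pos (show 0 < 1 + u by positivity)
  push_cast at h
  linarith

lemma norm_le_one_of_xi_eq_zero_of_im_eq_zero {a : ℂ} (h : xi a = 0) (him : a.im = 0) :
    ‖a‖ ≤ 1 := by
  obtain ⟨-, h1, h2⟩ := strip_of_xi_eq_zero h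
  simp at h1 h2
  have := Complex.norm_le_abs_re_add_abs_im a
  rw [him, abs_zero, add_zero] at this
  exact this.trans (abs_le.2 ⟨by linarith, by linarith⟩)

/-- Real zeros of `xi` need not be excluded: they lie in the unit disc, so a fixed finite set of
them contributes only `O(x)`. -/
lemma exists_sum_xiZeros_im_eq_zero_le :
    ∃ C : ℝ, 0 ≤ C ∧ ∀ x R : ℝ, 0 ≤ x → ∑ a ∈ xiZeros R with a.im = 0,
      (analyticOrderNatAt xi a : ℝ) * Real.log (1 + x ^ 2 / ‖a‖ ^ 2) ≤ C * x := by
  refine ⟨∑ a ∈ xiZeros 1, (analyticOrderNatAt xi a : ℝ) * (2 / ‖a‖),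
    Finset.sum_nonneg fun a _ => by positivity, fun x R hx => ?_⟩
  rw [Finset.sum_mul]
  refine sum_le_sum_of_injOn id (fun a ha => ?_) Function.injective_id (fun a ha => ?_)
    fun a _ => by positivity
  · obtain ⟨ha, him⟩ := Finset.mem_filter.1 ha
    obtain ⟨h1, h0, hR⟩ := mem_xiZeros.1 ha
    exact mem_xiZeros.2 ⟨h1, h0, norm_le_one_of_xi_eq_zero_of_im_eq_zero h0 him⟩
  · have := log_one_add_sq_le (u := x / ‖a‖) (by positivity)
    rw [div_pow] at this
    rw [id, mul_assoc]
    gcongr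
    exact this.trans_eq (by ring)

lemma exists_sum_xiZeros_le :
    ∃ C : ℝ, 0 ≤ C ∧ ∀ x R : ℝ, 0 ≤ x →
      ∑ a ∈ xiZeros R, (analyticOrderNatAt xi a : ℝ) * Real.log (1 + x ^ 2 / ‖a‖ ^ 2) ≤
        2 * ∑ ρ ∈ zerosUpTo R, (mult ρ : ℝ) * Real.log (1 + x ^ 2 / ρ.im ^ 2) + C * x := by
  obtain ⟨C, hC, hreal⟩ := exists_sum_xiZeros_im_eq_zero_le
  refine ⟨C, hC, fun x R hx => ?_⟩
  have h1 := sum_xiZeros_im_pos_le x R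
  have h2 := sum_xiZeros_im_neg_le x R
  have h3 := hreal x R hx
  rw [Finset.sum_filter] at h1 h2 h3
  have : ∑ a ∈ xiZeros R, (analyticOrderNatAt xi a : ℝ) * Real.log (1 + x ^ 2 / ‖a‖ ^ 2) =
      ∑ a ∈ xiZeros R, (((if 0 < a.im then
        (analyticOrderNatAt xi a : ℝ) * Real.log (1 + x ^ 2 / ‖a‖ ^ 2) else 0) +
      (if a.im < 0 then
        (analyticOrderNatAt xi a : ℝ) * Real.log (1 + x ^ 2 / ‖a‖ ^ 2) else 0)) +
      (if a.im = 0 then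
        (analyticOrderNatAt xi a : ℝ) * Real.log (1 + x ^ 2 / ‖a‖ ^ 2) else 0)) := by
    refine Finset.sum_congr rfl fun a _ => ?_
    rcases lt_trichotomy a.im 0 with h | h | h
    · simp [h, h.not_gt, h.ne]
    · simp [h]
    · simp [h, h.not_gt, h.ne']
  rw [this, Finset.sum_add_distrib, Finset.sum_add_distrib]
  linarith

/-- The exponential error in `norm_mul_norm_neg_le_prod` disappears as `R → ∞`, since growth of
exponent 3/2 is beaten by `R ^ 2`. -/
lemma tendsto_growth_div_sq (C D x : ℝ) :
    Tendsto (fun R : ℝ => 6 * (C * ((2 * R + 2) * √(2 * R + 2)) + D) * (x / R) ^ 2) atTop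
      (𝓝 0) := by
  have h1 : Tendsto (fun R : ℝ => (2 + 2 / R) * √(2 / R + 2 / R ^ 2)) atTop (𝓝 0) := by
    have ha : Tendsto (fun R : ℝ => 2 / R) atTop (𝓝 0) := tendsto_const_nhds.div_atTop tendsto_id
    have hb : Tendsto (fun R : ℝ => 2 / R ^ 2) atTop (𝓝 0) :=
      tendsto_const_nhds.div_atTop (tendsto_pow_atTop two_ne_zero)
    have hc := (Real.continuous_sqrt.tendsto 0).comp (by simpa using ha.add hb)
    simpa using (ha.const_add 2).mul hc
  have h2 : Tendsto (fun R : ℝ => D / R ^ 2) atTop (𝓝 0) :=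
    tendsto_const_nhds.div_atTop (tendsto_pow_atTop two_ne_zero)
  have h3 := ((h1.const_mul C).add h2).const_mul (6 * x ^ 2)
  simp only [mul_zero, add_zero] at h3
  refine h3.congr' ?_
  filter_upwards [eventually_gt_atTop 0] with R hR
  have : √(2 / R + 2 / R ^ 2) = √(2 * R + 2) / R := by
    rw [← Real.sqrt_sq hR.le, ← Real.sqrt_div' _ (by positivity), Real.sqrt_sq hR.le]
    congr 1
    field_simp
  rw [this]
  field_simp

/-- The logarithmic growth of `xi` on the real axis is accounted for by its zeros. -/
lemma exists_le_sum_log_one_add :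
    ∃ C : ℝ, ∀ x : ℝ, 8 ≤ x → ∀ᶠ R : ℝ in atTop,
      x / 2 * Real.log x - C * x ≤
        ∑ ρ ∈ zerosUpTo R, (mult ρ : ℝ) * Real.log (1 + x ^ 2 / ρ.im ^ 2) := by
  obtain ⟨A, hA, hgrowth⟩ := exists_norm_xi_le
  obtain ⟨B, hB, hsum⟩ := exists_sum_xiZeros_le
  have hxi1 : xi (1 / 2) ≠ 0 := by rw [xi_half]; exact one_ne_zero
  have htop := analyticOrderAt_ne_top_of_entire differentiable_xi hxi1
  -- A possible zero of `xi` at the origin, that is of zeta at `1 / 2`, is removed; it costs only `k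
  -- * log x`.
  obtain ⟨f, hf, hf0, hxif⟩ := exists_entire_eq_pow_mul differentiable_xi (htop 0)
  set k := analyticOrderNatAt xi 0
  simp only [sub_zero] at hxif
  have hford : ∀ a, a ≠ 0 → analyticOrderNatAt f a = analyticOrderNatAt xi a := by
    intro a ha
    have hp : Differentiable ℂ fun z : ℂ => z ^ k := by fun_prop
    have : analyticOrderAt xi a = analyticOrderAt f a := by
      rw [show xi = (fun z : ℂ => z ^ k) * f from funext hxif,
        analyticOrderAt_mul (hp.analyticAt a) (hf.analyticAt a),
        (hp.analyticAt a).analyticOrderAt_eq_zero.2 (pow_ne_zero _ ha), zero_add]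
    simp only [analyticOrderNatAt, this]
  have hpos0 : 0 < ‖f 0‖ := norm_pos_iff.2 hf0
  set D := |Real.log ‖f 0‖| + 1 with hD
  refine ⟨6 + k + D + B, fun x hx => ?_⟩
  have hsmall := (tendsto_growth_div_sq A D x).eventually_le_const zero_lt_one
  filter_upwards [hsmall, eventually_ge_atTop (2 * x), eventually_ge_atTop 1] with R hR1 hR2 hR3
  have hR0 : 0 < R := by linarith
  have hx0 : 0 < x := by linarith
  set K := A * ((2 * R + 2) * √(2 * R + 2)) + D with hK
  have hDpos : 0 < D := by positivity
  have hKpos : 0 < K := by positivity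
  have hxn : ‖(x : ℂ)‖ = x := by rw [Complex.norm_real, Real.norm_of_nonneg hx0.le]
  have hS : ∀ a ∈ ball (0 : ℂ) R, f a = 0 → a ∈ xiZeros R := by
    intro a ha hfa
    refine mem_xiZeros.2 ⟨?_, by rw [hxif, hfa, mul_zero], (mem_ball_zero_iff.1 ha).le⟩
    rintro rfl
    exact hf0 hfa
  have hbound : ∀ z, ‖z‖ = 2 * R → ‖f z‖ ≤ ‖f 0‖ * Real.exp K := by
    intro z hz
    have h1 : ‖f z‖ ≤ ‖xi z‖ := by
      rw [hxif, norm_mul, norm_pow]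
      exact le_mul_of_one_le_left (norm_nonneg _) (one_le_pow₀ (by linarith))
    have h2 := hgrowth z
    rw [hz] at h2
    refine h1.trans (h2.trans ?_)
    nth_rewrite 1 [← Real.exp_log hpos0]
    rw [← Real.exp_add]
    refine Real.exp_le_exp.2 ?_
    have := neg_abs_le (Real.log ‖f 0‖)
    linarith
  have hmain := norm_mul_norm_neg_le_prod hf hf0 hR0 hKpos
    (fun a ha => (mem_xiZeros.1 ha).1) (fun a ha => (mem_xiZeros.1 ha).2.2) hS hbound
    (x := (x : ℂ)) (by rw [hxn]; exact hR2)
  have hxiR := log_norm_xi_ge hx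
  have hfx : Real.log ‖f x‖ = Real.log ‖xi x‖ - k * Real.log x := by
    have hne : xi x ≠ 0 := by
      intro h
      have := re_lt_half_of_xi_eq_zero h
      simp at this
      linarith
    have hne' : f x ≠ 0 := by
      intro h
      exact hne (by rw [hxif, h, mul_zero])
    rw [hxif, norm_mul, norm_pow, hxn, Real.log_mul (by positivity) (norm_ne_zero_iff.2 hne'),
      Real.log_pow]
    ring
  have hfneg : ‖f (-x)‖ = ‖f x‖ := by
    have h := congrArg norm (xi_neg x)
    rw [hxif, hxif, norm_mul, norm_mul, norm_pow, norm_pow, norm_neg] at h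
    exact mul_left_cancel₀ (by rw [hxn]; positivity) h
  have hfxpos : 0 < ‖f x‖ := by
    refine norm_pos_iff.2 fun h => ?_
    have := re_lt_half_of_xi_eq_zero (z := x) (by rw [hxif, h, mul_zero])
    simp at this
    linarith
  have hprod : ∏ a ∈ xiZeros R, ‖1 - ((x : ℂ) / a) ^ 2‖ ^ analyticOrderNatAt f a ≤
      Real.exp (∑ a ∈ xiZeros R,
        (analyticOrderNatAt xi a : ℝ) * Real.log (1 + x ^ 2 / ‖a‖ ^ 2)) := by
    rw [Real.exp_sum]
    refine Finset.prod_le_prod (fun a _ => by positivity) fun a ha => ?_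
    rw [hford a (mem_xiZeros.1 ha).1, Real.exp_nat_mul, Real.exp_log (by positivity)]
    gcongr
    refine (norm_sub_le _ _).trans ?_
    rw [norm_one, norm_pow, norm_div, hxn, div_pow]
  rw [hfneg, ← sq, hxn] at hmain
  have hfin : ‖f x‖ ^ 2 ≤ Real.exp (2 * D) * Real.exp 1 * Real.exp (∑ a ∈ xiZeros R,
        (analyticOrderNatAt xi a : ℝ) * Real.log (1 + x ^ 2 / ‖a‖ ^ 2)) := by
    refine hmain.trans ?_
    have h0D : ‖f 0‖ ^ 2 ≤ Real.exp (2 * D) := by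
      rw [two_mul, Real.exp_add, sq]
      have : ‖f 0‖ ≤ Real.exp D := by
        rw [← Real.log_le_iff_le_exp hpos0]
        linarith [le_abs_self (Real.log ‖f 0‖)]
      gcongr
    gcongr
  rw [← Real.exp_add, ← Real.exp_add] at hfin
  have hlog := Real.log_le_log (by positivity) hfin
  rw [Real.log_exp, Real.log_pow, hfx] at hlog
  have hs := hsum x R hx0.le
  have hlx : Real.log x ≤ x := Real.log_le_self hx0.le
  have hklx : k * Real.log x ≤ k * x := by gcongr
  have hD1 : 1 ≤ D := by rw [hD]; linarith [abs_nonneg (Real.log ‖f 0‖)]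
  have hDx : D + 1 ≤ D * x := by nlinarith
  have hBx : 0 ≤ B * x := by positivity
  push_cast at hlog
  nlinarith

end ZetaPairs

namespace ZetaPairs

open Filter Topology Asymptotics Set MeasureTheory

/-! ### Partial summation -/

/-- Minus the derivative in `t` of `log (1 + x ^ 2 / t ^ 2)`. -/
noncomputable def logKernel (x t : ℝ) : ℝ := 2 * x ^ 2 / (t * (t ^ 2 + x ^ 2))

lemma hasDerivAt_neg_log_one_add {x t : ℝ} (ht : 0 < t) :
    HasDerivAt (fun t : ℝ => -Real.log (1 + x ^ 2 / t ^ 2)) (logKernel x t) t := by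
  have h1 : HasDerivAt (fun t : ℝ => 1 + x ^ 2 / t ^ 2) (-(2 * x ^ 2 / t ^ 3)) t := by
    have := ((hasDerivAt_const t (x ^ 2)).div (hasDerivAt_pow 2 t) (by positivity)).const_add 1
    refine this.congr_deriv ?_
    field_simp
    simp
    ring
  refine (h1.log (by positivity)).neg.congr_deriv ?_
  rw [logKernel]
  field_simp

lemma continuousOn_logKernel (x : ℝ) : ContinuousOn (logKernel x) (Ioi 0) := by
  intro t (ht : 0 < t)
  unfold logKernel
  refine ContinuousAt.continuousWithinAt (ContinuousAt.div (by fun_prop) (by fun_prop) ?_)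
  positivity

lemma log_one_add_eq_add_setIntegral {x c R : ℝ} (hc : 0 < c) (hcR : c ≤ R) :
    Real.log (1 + x ^ 2 / c ^ 2) =
      Real.log (1 + x ^ 2 / R ^ 2) + ∫ t in Ioc 0 R, (Ici c).indicator (logKernel x) t := by
  have hsub : Icc c R ⊆ Ioi 0 := fun t ht => hc.trans_le ht.1
  have hint : IntervalIntegrable (logKernel x) volume c R := by
    refine ContinuousOn.intervalIntegrable ?_
    rw [uIcc_of_le hcR]
    exact (continuousOn_logKernel x).mono hsub
  have h := intervalIntegral.integral_eq_sub_of_hasDerivAt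
    (fun t ht => hasDerivAt_neg_log_one_add (x := x) (hsub (uIcc_of_le hcR ▸ ht))) hint
  rw [setIntegral_indicator measurableSet_Ici,
    show Ioc 0 R ∩ Ici c = Icc c R by
      ext t
      simp only [mem_inter_iff, mem_Ioc, mem_Ici, mem_Icc]
      exact ⟨fun h => ⟨h.2, h.1.2⟩, fun h => ⟨⟨hc.trans_le h.1, h.2⟩, h.1⟩⟩,
    integral_Icc_eq_integral_Ioc, ← intervalIntegral.integral_of_le hcR, h]
  ring

lemma integrableOn_indicator_logKernel {x c R : ℝ} (hc : 0 < c) :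
    IntegrableOn ((Ici c).indicator (logKernel x)) (Ioc 0 R) := by
  rw [integrableOn_indicator_iff measurableSet_Ici]
  have : IntegrableOn (logKernel x) (Icc c R) :=
    ((continuousOn_logKernel x).mono fun t ht => hc.trans_le ht.1).integrableOn_Icc
  exact this.mono_set fun t ht => ⟨ht.1, ht.2.2⟩

lemma N_eq_sum_indicator {t R : ℝ} (htR : t ≤ R) :
    (N t : ℝ) = ∑ ρ ∈ zerosUpTo R, (mult ρ : ℝ) * (Ici ρ.im).indicator 1 t := by
  have h : zerosUpTo t = (zerosUpTo R).filter fun ρ => ρ.im ≤ t := by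
    ext ρ
    simp only [Finset.mem_filter, mem_zerosUpTo]
    constructor
    · rintro ⟨h1, h2, h3, h4, h5⟩
      exact ⟨⟨h1, h2, h3, h4, h5.trans htR⟩, h5⟩
    · rintro ⟨⟨h1, h2, h3, h4, -⟩, h5⟩
      exact ⟨h1, h2, h3, h4, h5⟩
  rw [N, h, Finset.sum_filter, Nat.cast_sum]
  refine Finset.sum_congr rfl fun ρ _ => ?_
  by_cases hρ : ρ.im ≤ t <;> simp [hρ]

/-- Each logarithm is the integral of `logKernel` from `γ` to `R` plus its value at `R`; exchanging
the finite sum with the integral produces `N t`. -/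
lemma sum_log_one_add_eq (x R : ℝ) :
    ∑ ρ ∈ zerosUpTo R, (mult ρ : ℝ) * Real.log (1 + x ^ 2 / ρ.im ^ 2) =
      N R * Real.log (1 + x ^ 2 / R ^ 2) + ∫ t in Ioc 0 R, (N t : ℝ) * logKernel x t := by
  have h1 : ∫ t in Ioc 0 R, (N t : ℝ) * logKernel x t =
      ∫ t in Ioc 0 R, ∑ ρ ∈ zerosUpTo R, (mult ρ : ℝ) * (Ici ρ.im).indicator (logKernel x) t := by
    refine setIntegral_congr_fun measurableSet_Ioc fun t ht => ?_
    rw [N_eq_sum_indicator ht.2, Finset.sum_mul]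
    refine Finset.sum_congr rfl fun ρ _ => ?_
    by_cases hρ : ρ.im ≤ t <;> simp [hρ]
  rw [h1, integral_finsetSum _ fun ρ hρ =>
    (integrableOn_indicator_logKernel (mem_zerosUpTo.1 hρ).2.2.2.1).const_mul _, N, Nat.cast_sum,
    Finset.sum_mul, ← Finset.sum_add_distrib]
  refine Finset.sum_congr rfl fun ρ hρ => ?_
  obtain ⟨-, -, -, h2, h3⟩ := mem_zerosUpTo.1 hρ
  rw [log_one_add_eq_add_setIntegral h2 h3, integral_const_mul, mul_add]

lemma N_mono : Monotone N := by
  intro t R htR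
  refine Finset.sum_le_sum_of_subset fun ρ hρ => ?_
  obtain ⟨h1, h2, h3, h4, h5⟩ := mem_zerosUpTo.1 hρ
  exact mem_zerosUpTo.2 ⟨h1, h2, h3, h4, h5.trans htR⟩

/-- Makes a linear bound `N t ≤ B * t` possible near 0, where the kernel is singular. -/
lemma exists_N_eq_zero : ∃ c : ℝ, 0 < c ∧ ∀ t < c, N t = 0 := by
  have hfin : ((fun ρ : ℂ => ρ.im) '' zerosUpTo 1).Finite := (zerosUpTo 1).finite_toSet.image _
  have h0 : (0 : ℝ) ∉ (fun ρ : ℂ => ρ.im) '' zerosUpTo 1 := by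
    rintro ⟨ρ, hρ, h⟩
    exact (mem_zerosUpTo.1 hρ).2.2.2.1.ne' h
  obtain ⟨c, hc, hball⟩ := Metric.isOpen_iff.1 hfin.isClosed.isOpen_compl 0 h0
  refine ⟨min c 1, by positivity, fun t ht => ?_⟩
  refine Finset.sum_eq_zero fun ρ hρ => ?_
  obtain ⟨h1, h2, h3, h4, h5⟩ := mem_zerosUpTo.1 hρ
  have h6 : ρ.im < c := h5.trans_lt (ht.trans_le (min_le_left _ _))
  have h7 : ρ.im ≤ 1 := h5.trans (ht.le.trans (min_le_right _ _))
  have hmem : ρ.im ∈ Metric.ball (0 : ℝ) c := by simpa [abs_of_pos h4] using h6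
  exact absurd ⟨ρ, mem_zerosUpTo.2 ⟨h1, h2, h3, h4, h7⟩, rfl⟩ (hball hmem)

/-! ### From an integrated lower bound to a pointwise one -/

lemma tendsto_arctan_div {x : ℝ} (hx : 0 < x) :
    Tendsto (fun t : ℝ => 2 * x * Real.arctan (t / x)) atTop (𝓝 (Real.pi * x)) := by
  have h1 := (Real.tendsto_arctan_atTop.mono_right nhdsWithin_le_nhds).comp
    (tendsto_id.atTop_div_const hx)
  have h2 := h1.const_mul (2 * x)
  rwa [show 2 * x * (Real.pi / 2) = Real.pi * x by ring] at h2

lemma hasDerivAt_arctan_div {x : ℝ} (hx : 0 < x) (t : ℝ) :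
    HasDerivAt (fun t : ℝ => 2 * x * Real.arctan (t / x)) (2 * x ^ 2 / (t ^ 2 + x ^ 2)) t := by
  refine (((hasDerivAt_id t).div_const x).arctan.const_mul (2 * x)).congr_deriv ?_
  simp only [id]
  field_simp
  ring

lemma integrableOn_poisson {x : ℝ} (hx : 0 < x) :
    IntegrableOn (fun t : ℝ => 2 * x ^ 2 / (t ^ 2 + x ^ 2)) (Ioi 0) :=
  integrableOn_Ioi_deriv_of_nonneg' (fun t _ => hasDerivAt_arctan_div hx t)
    (fun t _ => by positivity) (tendsto_arctan_div hx)

lemma integral_poisson {x : ℝ} (hx : 0 < x) :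
    ∫ t in Ioi (0 : ℝ), 2 * x ^ 2 / (t ^ 2 + x ^ 2) = Real.pi * x := by
  rw [integral_Ioi_of_hasDerivAt_of_nonneg' (fun t _ => hasDerivAt_arctan_div hx t)
    (fun t _ => by positivity) (tendsto_arctan_div hx)]
  simp

/-- An integrable majorant of `log (t / x)` times the Poisson kernel. -/
noncomputable def logMajorant (x t : ℝ) : ℝ := 8 / (√(t / x) * (1 + t / x))

lemma tendsto_arctan_sqrt {x : ℝ} (hx : 0 < x) :
    Tendsto (fun t : ℝ => 16 * x * Real.arctan √(t / x)) atTop (𝓝 (8 * Real.pi * x)) := by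
  have h1 := (Real.tendsto_arctan_atTop.mono_right nhdsWithin_le_nhds).comp
    (Real.tendsto_sqrt_atTop.comp (tendsto_id.atTop_div_const hx))
  have h2 := h1.const_mul (16 * x)
  rwa [show 16 * x * (Real.pi / 2) = 8 * Real.pi * x by ring] at h2

lemma hasDerivAt_arctan_sqrt {x t : ℝ} (hx : 0 < x) (ht : 0 < t) :
    HasDerivAt (fun t : ℝ => 16 * x * Real.arctan √(t / x)) (logMajorant x t) t := by
  have hpos : 0 < t / x := by positivity
  have h := ((((hasDerivAt_id t).div_const x).sqrt hpos.ne').arctan).const_mul (16 * x)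
  refine h.congr_deriv ?_
  simp only [id, logMajorant]
  rw [Real.sq_sqrt hpos.le]
  have : 0 < √(t / x) := Real.sqrt_pos.2 hpos
  field_simp
  ring

lemma continuousWithinAt_arctan_sqrt (x : ℝ) :
    ContinuousWithinAt (fun t : ℝ => 16 * x * Real.arctan √(t / x)) (Ici 0) 0 := by
  refine Continuous.continuousWithinAt ?_
  exact continuous_const.mul (Real.continuous_arctan.comp
    (Real.continuous_sqrt.comp (continuous_id.div_const x)))

lemma logMajorant_nonneg {x t : ℝ} (hx : 0 < x) (ht : 0 < t) : 0 ≤ logMajorant x t := by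
  unfold logMajorant
  positivity

lemma integrableOn_logMajorant {x : ℝ} (hx : 0 < x) : IntegrableOn (logMajorant x) (Ioi 0) :=
  integrableOn_Ioi_deriv_of_nonneg (continuousWithinAt_arctan_sqrt x)
    (fun _ ht => hasDerivAt_arctan_sqrt hx ht) (fun _ ht => logMajorant_nonneg hx ht)
    (tendsto_arctan_sqrt hx)

lemma integral_logMajorant {x : ℝ} (hx : 0 < x) :
    ∫ t in Ioi (0 : ℝ), logMajorant x t = 8 * Real.pi * x := by
  rw [integral_Ioi_of_hasDerivAt_of_nonneg (continuousWithinAt_arctan_sqrt x)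
    (fun _ ht => hasDerivAt_arctan_sqrt hx ht) (fun _ ht => logMajorant_nonneg hx ht)
    (tendsto_arctan_sqrt hx)]
  simp

lemma two_mul_sqrt_mul_poisson_le {x t : ℝ} (hx : 0 < x) (ht : 0 < t) :
    2 * √(t / x) * (2 * x ^ 2 / (t ^ 2 + x ^ 2)) ≤ logMajorant x t := by
  obtain ⟨u, hu⟩ : ∃ u, u = t / x := ⟨_, rfl⟩
  have hupos : 0 < u := hu ▸ by positivity
  have ht' : t = u * x := by rw [hu]; field_simp
  have h1 : 2 * x ^ 2 / (t ^ 2 + x ^ 2) = 2 / (u ^ 2 + 1) := by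
    rw [ht']
    field_simp
  rw [logMajorant, ← hu, h1]
  have hs : 0 < √u := Real.sqrt_pos.2 hupos
  rw [mul_div_assoc', div_le_div_iff₀ (by positivity) (by positivity)]
  have : √u * √u = u := Real.mul_self_sqrt hupos.le
  calc 2 * √u * 2 * (√u * (1 + u)) = 4 * (√u * √u) * (1 + u) := by ring
    _ = 4 * u * (1 + u) := by rw [this]
    _ ≤ 8 * (u ^ 2 + 1) := by nlinarith [sq_nonneg (u - 1)]

/-- Freezes `log t` at `log x`; the error, integrated against the Poisson kernel, is only `O(x)`. -/
lemma log_le_log_add_two_mul_sqrt {x t : ℝ} (hx : 0 < x) (ht : 0 < t) :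
    Real.log t ≤ Real.log x + 2 * √(t / x) := by
  have h := Real.log_le_self (Real.sqrt_nonneg (t / x))
  rw [Real.log_sqrt (by positivity), Real.log_div ht.ne' hx.ne'] at h
  linarith

lemma mul_logKernel {x t : ℝ} (ht : 0 < t) :
    t * logKernel x t = 2 * x ^ 2 / (t ^ 2 + x ^ 2) := by
  rw [logKernel]
  field_simp

lemma le_setIntegral_poisson {x δ : ℝ} (hx : 0 < x) (hδ : 0 < δ) (hδ1 : δ < 1) :
    δ * x ≤ ∫ t in Ioc ((1 - δ) * x) x, 2 * x ^ 2 / (t ^ 2 + x ^ 2) := by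
  have hsub : Ioc ((1 - δ) * x) x ⊆ Ioi 0 := fun t ht =>
    (mul_pos (by linarith) hx).trans ht.1
  calc δ * x = ∫ _ in Ioc ((1 - δ) * x) x, (1 : ℝ) := by
        rw [setIntegral_const, smul_eq_mul, mul_one, Real.volume_real_Ioc_of_le (by nlinarith)]
        ring
    _ ≤ _ := by
        refine setIntegral_mono_on (by simp) ((integrableOn_poisson hx).mono_set hsub)
          measurableSet_Ioc fun t ht => ?_
        have ht0 : 0 < t := hsub ht
        rw [le_div_iff₀ (by positivity)]
        nlinarith [ht.2]

/-- If `n` is bounded above by its expected main term, then a deficit just below `x` lowers the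
integral of `n` against the kernel. -/
lemma setIntegral_mul_logKernel_le {n : ℝ → ℝ} (hn : Monotone n) (hn0 : ∀ t, 0 ≤ n t)
    {x a b δ : ℝ} (hx : 0 < x) (hb : 0 ≤ b) (hδ : 0 < δ) (hδ1 : δ < 1) {d : ℝ}
    (hup : ∀ t, 0 < t → n t ≤ t * (a + b * (2 * √(t / x))))
    (hdef : ∀ t ∈ Ioc ((1 - δ) * x) x, n t ≤ t * (a + b * (2 * √(t / x))) - t * d)
    (hd : 0 ≤ d) (R : ℝ) :
    ∫ t in Ioc 0 R, n t * logKernel x t ≤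
      a * (Real.pi * x) + b * (8 * Real.pi * x) - d * (δ * x) := by
  set V : ℝ → ℝ := fun t => a * (2 * x ^ 2 / (t ^ 2 + x ^ 2)) + b * logMajorant x t -
    d * (Ioc ((1 - δ) * x) x).indicator (fun t => 2 * x ^ 2 / (t ^ 2 + x ^ 2)) t with hV
  have hsub : Ioc ((1 - δ) * x) x ⊆ Ioi 0 := fun t ht =>
    (mul_pos (by linarith) hx).trans ht.1
  have hi1 := (integrableOn_poisson hx).const_mul a
  have hi2 := (integrableOn_logMajorant hx).const_mul b
  have hi3 := ((integrableOn_poisson hx).indicator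
    (measurableSet_Ioc (a := (1 - δ) * x) (b := x))).const_mul d
  have hVint : IntegrableOn V (Ioi 0) := (hi1.add hi2).sub hi3
  have hk : ∀ t, 0 < t → 0 ≤ logKernel x t := fun t ht => by unfold logKernel; positivity
  have hnV : ∀ t ∈ Ioi (0 : ℝ), n t * logKernel x t ≤ V t := by
    intro t (ht : 0 < t)
    have hmaj := mul_le_mul_of_nonneg_left (two_mul_sqrt_mul_poisson_le hx ht) hb
    have hP := mul_logKernel (x := x) ht
    by_cases hmem : t ∈ Ioc ((1 - δ) * x) x
    · have h := mul_le_mul_of_nonneg_right (hdef t hmem) (hk t ht)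
      simp only [hV, indicator_of_mem hmem]
      rw [← hP] at hmaj ⊢
      nlinarith
    · have h := mul_le_mul_of_nonneg_right (hup t ht) (hk t ht)
      simp only [hV, indicator_of_notMem hmem]
      rw [← hP] at hmaj ⊢
      nlinarith
  have hnn : ∀ t ∈ Ioi (0 : ℝ), 0 ≤ n t * logKernel x t := fun t ht =>
    mul_nonneg (hn0 t) (hk t ht)
  have hnint : IntegrableOn (fun t => n t * logKernel x t) (Ioi 0) := by
    refine Integrable.mono' hVint ?_ ?_
    · exact (hn.measurable.aestronglyMeasurable).mul
        ((continuousOn_logKernel x).aestronglyMeasurable measurableSet_Ioi)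
    · filter_upwards [ae_restrict_mem measurableSet_Ioi] with t ht
      rw [Real.norm_of_nonneg (hnn t ht)]
      exact hnV t ht
  calc ∫ t in Ioc 0 R, n t * logKernel x t
      ≤ ∫ t in Ioi 0, n t * logKernel x t := by
        refine setIntegral_mono_set hnint ?_ (Ioc_subset_Ioi_self.eventuallyLE)
        filter_upwards [ae_restrict_mem measurableSet_Ioi] with t ht using hnn t ht
    _ ≤ ∫ t in Ioi 0, V t := setIntegral_mono_on hnint hVint measurableSet_Ioi hnV
    _ = a * (Real.pi * x) + b * (8 * Real.pi * x) -
          d * ∫ t in Ioc ((1 - δ) * x) x, 2 * x ^ 2 / (t ^ 2 + x ^ 2) := by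
        have e1 : ∫ t in Ioi 0, V t = _ := integral_sub (hi1.add hi2) hi3
        rw [e1]
        have e2 := integral_add hi1 hi2
        rw [e2, integral_const_mul, integral_const_mul, integral_const_mul,
          integral_poisson hx, integral_logMajorant hx, setIntegral_indicator measurableSet_Ioc,
          inter_eq_right.2 hsub]
    _ ≤ _ := by
        have := mul_le_mul_of_nonneg_left (le_setIntegral_poisson hx hδ hδ1) hd
        linarith

lemma tendsto_mul_L_mul_log_one_add (x : ℝ) :
    Tendsto (fun R : ℝ => 2 * (R * L R) * Real.log (1 + x ^ 2 / R ^ 2)) atTop (𝓝 0) := by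
  have h1 : Tendsto (fun R : ℝ => x ^ 2 / Real.pi * (Real.log R / R)) atTop (𝓝 0) := by
    have : Tendsto (fun R : ℝ => Real.log R / R) atTop (𝓝 0) := by
      simpa using Real.isLittleO_log_id_atTop.tendsto_div_nhds_zero
    simpa using this.const_mul (x ^ 2 / Real.pi)
  refine squeeze_zero' ?_ ?_ h1
  · filter_upwards [eventually_ge_atTop 1] with R hR
    have := Real.log_nonneg hR
    have h2 := log_one_add_sq_div_nonneg x R
    unfold L
    positivity
  · filter_upwards [eventually_ge_atTop 1] with R hR
    have hR0 : 0 < R := by linarith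
    have hl := Real.log_nonneg hR
    have h2 : Real.log (1 + x ^ 2 / R ^ 2) ≤ x ^ 2 / R ^ 2 := by
      have := Real.log_le_sub_one_of_pos (show 0 < 1 + x ^ 2 / R ^ 2 by positivity)
      linarith
    unfold L
    calc 2 * (R * (Real.log R / (2 * Real.pi))) * Real.log (1 + x ^ 2 / R ^ 2)
        ≤ 2 * (R * (Real.log R / (2 * Real.pi))) * (x ^ 2 / R ^ 2) := by gcongr
      _ = x ^ 2 / Real.pi * (Real.log R / R) := by field_simp

lemma eventually_le_of_integrated {n : ℝ → ℝ} (hn : Monotone n) (hn0 : ∀ t, 0 ≤ n t)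
    {c : ℝ} (hc : 0 < c) (hnc : ∀ t < c, n t = 0)
    (hup : ∀ ε > 0, ∀ᶠ t : ℝ in atTop, n t ≤ (1 + ε) * (t * L t)) {C : ℝ}
    (hlow : ∀ x : ℝ, 8 ≤ x → ∀ᶠ R : ℝ in atTop, x / 2 * Real.log x - C * x ≤
      n R * Real.log (1 + x ^ 2 / R ^ 2) + ∫ t in Ioc 0 R, n t * logKernel x t)
    {η : ℝ} (hη : 0 < η) (hη1 : η < 1) : ∀ᶠ T : ℝ in atTop, (1 - η) * (T * L T) ≤ n T := by
  have hπ := Real.pi_pos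
  set δ := η / 2 with hδdef
  have hδ : 0 < δ := by positivity
  have hδ1 : δ < 1 := by linarith
  set ε := δ ^ 2 / (2 * Real.pi) with hε
  have hεpos : 0 < ε := by positivity
  obtain ⟨T₀, hT₀⟩ := eventually_atTop.1 (hup ε hεpos)
  set T₁ := max T₀ 1
  set B := n T₁ / c with hB
  have hBnn : 0 ≤ B := div_nonneg (hn0 _) hc.le
  set b := (1 + ε) / (2 * Real.pi) with hb
  have hbpos : 0 < b := by positivity
  set M := C + 1 + B * Real.pi + b * (8 * Real.pi) with hM
  filter_upwards [eventually_ge_atTop 8,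
    Real.tendsto_log_atTop.eventually_gt_atTop (M / (ε / 2))] with T hT8 hTlog
  by_contra! hbad
  have hT0 : 0 < T := by linarith
  have hlogT : 0 < Real.log T := Real.log_pos (by linarith)
  -- Three ranges: `n` vanishes below `c`, is at most `c * B ≤ t * B` up to `T₁`, and obeys the
  -- asymptotic upper bound beyond.
  have hbound : ∀ t, 0 < t → n t ≤ t * (B + b * Real.log T + b * (2 * √(t / T))) := by
    intro t ht
    rcases lt_or_ge t c with h | h
    · rw [hnc t h]
      positivity
    rcases le_total t T₁ with h1 | h1
    · have h2 : n t ≤ t * B := by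
        calc n t ≤ n T₁ := hn h1
          _ = c * B := by rw [hB]; field_simp
          _ ≤ t * B := by gcongr
      have h3 : 0 ≤ t * (b * Real.log T + b * (2 * √(t / T))) := by positivity
      nlinarith
    · have h2 := hT₀ t ((le_max_left _ _).trans h1)
      have h3 : (1 + ε) * (t * L t) = t * (b * Real.log t) := by
        rw [L, hb]
        field_simp
      rw [h3] at h2
      have h4 := mul_le_mul_of_nonneg_left (log_le_log_add_two_mul_sqrt hT0 ht) hbpos.le
      have h5 := mul_le_mul_of_nonneg_left h4 ht.le
      have h6 : 0 ≤ t * B := by positivity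
      nlinarith
  set d := δ * Real.log T / (2 * Real.pi) with hd
  have hdnn : 0 ≤ d := by positivity
  have hdef : ∀ t ∈ Ioc ((1 - δ) * T) T,
      n t ≤ t * (B + b * Real.log T + b * (2 * √(t / T))) - t * d := by
    rintro t ⟨ht1, ht2⟩
    have ht0 : 0 < t := (mul_pos (by linarith) hT0).trans ht1
    have h1 : n t ≤ (1 - η) * (T * L T) := (hn ht2).trans hbad.le
    have hLT : 0 < L T := by unfold L; positivity
    -- Since `η = 2 * δ`, `1 - η ≤ (1 - δ) ^ 2`: half of the deficit survives down to `(1 - δ) * T`.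
    have h2 : (1 - η) * T ≤ (1 - δ) * t := by nlinarith
    have h3 : n t ≤ (1 - δ) * t * L T := by
      refine h1.trans ?_
      rw [← mul_assoc]
      gcongr
    have h4 : L T ≤ b * Real.log T := by
      rw [L, hb, div_mul_eq_mul_div]
      gcongr
      nlinarith
    have h5 : d = δ * L T := by rw [hd, L]; ring
    have h6 : 0 ≤ t * (B + b * (2 * √(t / T))) := by positivity
    have h7 := mul_le_mul_of_nonneg_left h4 ht0.le
    rw [h5]
    nlinarith
  have hsmall : ∀ᶠ R : ℝ in atTop, n R * Real.log (1 + T ^ 2 / R ^ 2) ≤ 1 := by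
    filter_upwards [hup 1 one_pos,
      (tendsto_mul_L_mul_log_one_add T).eventually_le_const zero_lt_one] with R h1 h2
    refine le_trans ?_ h2
    gcongr
    · exact log_one_add_sq_div_nonneg T R
    · linarith
  obtain ⟨R, hR1, hR2⟩ := ((hlow T hT8).and hsmall).exists
  have hI := setIntegral_mul_logKernel_le hn hn0 hT0 hbpos.le hδ hδ1 hbound hdef hdnn R
  have hmain : T / 2 * Real.log T - C * T ≤ 1 + ((B + b * Real.log T) * (Real.pi * T) +
      b * (8 * Real.pi * T) - d * (δ * T)) := by linarith
  have hbT : b * Real.log T * (Real.pi * T) = (1 + ε) * (T / 2 * Real.log T) := by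
    rw [hb]
    field_simp
  have hdT : d * (δ * T) = ε * (T * Real.log T) := by
    rw [hd, hε]
    field_simp
  -- The terms `(T / 2) log T` cancel; the net loss `(ε / 2) T log T` would have to be `O(T)`,
  -- contradicting the choice of `T`.
  have hfinal : ε / 2 * Real.log T * T ≤ M * T := by
    rw [hM]
    nlinarith
  have h8 : ε / 2 * Real.log T ≤ M := le_of_mul_le_mul_right hfinal hT0
  rw [div_lt_iff₀ (by positivity)] at hTlog
  linarith

/-! ### Conclusion -/

lemma NCirc_eventually_le (hES1 : ES1) {ε : ℝ} (hε : 0 < ε) :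
    ∀ᶠ T : ℝ in atTop, (NCirc T : ℝ) ≤ (1 + ε) * (T * L T) := by
  filter_upwards [hES1.def hε, tendsto_mul_L_atTop.eventually_ge_atTop 0] with T h1 h2
  rw [Real.norm_eq_abs, Real.norm_of_nonneg h2] at h1
  linarith [le_abs_self ((NCirc T : ℝ) - T * L T)]

lemma isEquivalent_N (hES1 : ES1) :
    (fun T : ℝ => (N T : ℝ)) ~[atTop] fun T => T * L T := by
  have hup : ∀ ε > 0, ∀ᶠ T : ℝ in atTop, (N T : ℝ) ≤ (1 + ε) * (T * L T) := by
    intro ε hε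
    filter_upwards [NCirc_eventually_le hES1 hε] with T hT
    exact le_trans (by exact_mod_cast N_le_NCirc T) hT
  obtain ⟨C, hC⟩ := exists_le_sum_log_one_add
  obtain ⟨c, hc, hNc⟩ := exists_N_eq_zero
  refine isLittleO_iff.2 fun ε hε => ?_
  have hη : 0 < min ε (1 / 2) := by positivity
  have hlow := eventually_le_of_integrated (n := fun T => (N T : ℝ))
    (fun s t hst => Nat.cast_le.2 (N_mono hst)) (fun t => Nat.cast_nonneg _) hc
    (fun t ht => by simp [hNc t ht]) hup (C := C)
    (fun x hx => (hC x hx).mono fun R hR => by rwa [sum_log_one_add_eq] at hR) hη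
    ((min_le_right _ _).trans_lt (by norm_num))
  filter_upwards [hup ε hε, hlow, tendsto_mul_L_atTop.eventually_ge_atTop 0] with T h1 h2 h3
  rw [Pi.sub_apply, Real.norm_eq_abs, Real.norm_of_nonneg h3, abs_le]
  have := mul_le_mul_of_nonneg_right (min_le_left ε (1 / 2)) h3
  constructor <;> nlinarith

end ZetaPairs

theorem theorem2 (hES1 : ZetaPairs.ES1) :
    Asymptotics.IsEquivalent Filter.atTop
        (fun T : ℝ => (ZetaPairs.NSimple T : ℝ)) (fun T : ℝ => (ZetaPairs.N T : ℝ)) ∧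
      Asymptotics.IsEquivalent Filter.atTop
        (fun T : ℝ => (ZetaPairs.NLine T : ℝ)) (fun T : ℝ => (ZetaPairs.N T : ℝ)) ∧
      Asymptotics.IsEquivalent Filter.atTop
        (fun T : ℝ => (ZetaPairs.NSimpleLine T : ℝ)) (fun T : ℝ => (ZetaPairs.N T : ℝ)) := by
  have hN := ZetaPairs.isEquivalent_N hES1
  have h := ZetaPairs.two_mul_N_le
  have hs := ZetaPairs.NSimpleLine_le_NSimple
  have hl := ZetaPairs.NSimpleLine_le_NLine
  refine ⟨ZetaPairs.isEquivalent_N_of_two_mul_N_le hES1 hN (fun T => ?_) ZetaPairs.NSimple_le_N,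
    ZetaPairs.isEquivalent_N_of_two_mul_N_le hES1 hN (fun T => ?_) ZetaPairs.NLine_le_N,
    ZetaPairs.isEquivalent_N_of_two_mul_N_le hES1 hN h fun T =>
      (hs T).trans (ZetaPairs.NSimple_le_N T)⟩
  · exact (h T).trans (Nat.add_le_add_left (hs T) _)
  · exact (h T).trans (Nat.add_le_add_left (hl T) _)
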